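/- Let $n\in\mathbb N$ and let $h$ range over a set $H\subseteq(0,1]$ (for instance $H=(0,h_0]$, or a sequence tending to $0$); all $\mathcal O(\cdot)$ are uniform in $h\in H$. A function $m:T^*\mathbb R^n=\mathbb R^n\times\mathbb R^n\to[0,\infty)$ is an order function if, for some $C,N$, $m(x,\xi)\le C(1+|x-y|+|\xi-\eta|)^N m(y,\eta)$ for all $(x,\xi),(y,\eta)$. A family $a=a(x,\xi;h)$ of smooth complex-valued functions on $T^*\mathbb R^n$ is in $S(m)$ if $|\partial^\alpha_{x,\xi}a|\le C_\alpha m$ for all $\alpha$, with $C_\alpha$ independent of $h\in H$. The left semiclassical quantization is $$a(x,hD)u(x)=\frac1{(2\pi h)^n}\iint e^{\frac ih\langle x-y,\xi\rangle}a(x,\xi;h)\,u(y)\,dy\,d\xi ,$$ defined on $\mathcal S(\mathbb R^n)$ and extended to $\mathcal S'(\mathbb R^n)$ by duality. **Theorem.** Let $m$ be an order function and let $P=a(x,hD)$ with $a\in S(m)$ have principal symbol $p\in S(m)$, i.e. $a-p\in hS(m)$. Let $u(h)\in L^2(\mathbb R^n)$, $h\in H$, satisfy $\|u(h)\|_{L^2}=\mathcal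 O(1)$ and be localized in phase space: $$u(h)=\chi(x,hD)u(h)+\mathcal O_{\mathcal S}(h^\infty)$$ for some $\chi\in C_c^\infty(T^*\mathbb R^n)$, which may depend on $h$ provided that its support stays in a fixed compact set and each of its derivatives is bounded uniformly in $h$. Here $r(h)=\mathcal O_{\mathcal S}(h^\infty)$ means that every Schwartz seminorm of $r(h)$ is $\mathcal O(h^N)$ for every $N$. Suppose that, for some $C>0$ independent of $h$, $$Pu(h)=\mathcal O_{L^2}(h),\qquad |p(x,\xi;h)|\ge 1/C\quad\text{for }(x,\xi)\in\operatorname{supp}\chi ,\ h\in H .$$ Then for every $2\le q\le\infty$ (with $1/\infty=0$), $$\|u(h)\|_{L^q(\mathbb R^n)}=\mathcal O\big(h^{\,1-n(1/2-1/q)}\big),\qquad h\in H .$$ -/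

import Mathlib

open scoped ContDiff

namespace Semiclassical

/-- Position space `ℝⁿ` with its Euclidean norm. -/
abbrev Space (n : ℕ) := EuclideanSpace ℝ (Fin n)

/-- Phase space `T*ℝⁿ = ℝⁿ × ℝⁿ`; a point is `(x, ξ)`. -/
abbrev Phase (n : ℕ) := Space n × Space n

/-- Order functions on phase space. -/
structure IsOrderFunction {n : ℕ} (m : Phase n → ℝ) : Prop where
  nonneg : ∀ z, 0 ≤ m z
  growth : ∃ (C : ℝ) (N : ℕ), ∀ x ξ y η : Space n,
    m (x, ξ) ≤ C * (1 + ‖x - y‖ + ‖ξ - η‖) ^ N * m (y, η)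

/-- The `h`-dependent symbol `a`, with `h` ranging over `H`, belongs to `S(m)`: each `a h` is
smooth and every derivative is bounded by a constant times `m`, uniformly in `h ∈ H`. -/
structure IsSymbol {n : ℕ} (H : Set ℝ) (m : Phase n → ℝ) (a : ℝ → Phase n → ℂ) : Prop where
  smooth : ∀ h ∈ H, ContDiff ℝ ∞ (a h)
  bound : ∀ k : ℕ, ∃ C : ℝ, ∀ h ∈ H, ∀ z, ‖iteratedFDeriv ℝ k (a h) z‖ ≤ C * m z

/-- `p` is a principal symbol of `a` in `S(m)`: both lie in `S(m)` and `a - p ∈ h S(m)`. -/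
structure IsPrincipalSymbol {n : ℕ} (H : Set ℝ) (m : Phase n → ℝ)
    (a p : ℝ → Phase n → ℂ) : Prop where
  full : IsSymbol H m a
  principal : IsSymbol H m p
  difference : IsSymbol H m (fun h z => (h : ℂ)⁻¹ * (a h z - p h z))

/-- Cutoffs: bounded families in `C_c^∞(T*ℝⁿ)`, that is, with all supports in one compact set and
all derivatives bounded uniformly in `h`. A single compactly supported smooth function is the case
of a constant family. -/
structure IsCutoff {n : ℕ} (H : Set ℝ) (χ : ℝ → Phase n → ℂ) : Prop where
  symbol : IsSymbol H (fun _ => 1) χ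
  support : ∃ K : Set (Phase n), IsCompact K ∧ ∀ h ∈ H, tsupport (χ h) ⊆ K

/-- The transpose of the left quantization
`a(x,hD)u(x) = (2πh)⁻ⁿ ∬ e^{i⟨x-y,ξ⟩/h} a(x,ξ) u(y) dy dξ`, applied to `φ`:
`y ↦ (2πh)⁻ⁿ ∫ (∫ e^{i⟨x-y,ξ⟩/h} a(x,ξ) φ(x) dx) dξ`.
For `φ` a Schwartz function, `a` a symbol and `h > 0`, the inner integral converges absolutely and
decays rapidly in `ξ`, and the result is a Schwartz function of `y`. -/
noncomputable def quantizationTranspose {n : ℕ} (h : ℝ) (a : Phase n → ℂ) (φ : Space n → ℂ)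
    (y : Space n) : ℂ :=
  (((2 * Real.pi * h) ^ n : ℝ) : ℂ)⁻¹ *
    ∫ ξ : Space n, ∫ x : Space n,
      Complex.exp (Complex.I * ((inner ℝ (x - y) ξ / h : ℝ) : ℂ)) * a (x, ξ) * φ x

/-- `a(x,hD)u = f` in the sense of tempered distributions, for `u, f ∈ L²(ℝⁿ)`; here `a(x,hD)` is
the left semiclassical quantization, extended from `𝓢` to `𝓢'` by duality. -/
def QuantizationEq {n : ℕ} (h : ℝ) (a : Phase n → ℂ) (u f : Space n → ℂ) : Prop :=
  ∀ φ : SchwartzMap (Space n) ℂ,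
    ∫ x, f x * φ x = ∫ y, u y * quantizationTranspose h a φ y

/-- `r = O_𝓢(h^∞)`: every Schwartz seminorm of `r h` is `O(h^N)` for every `N`. -/
def IsNegligible {n : ℕ} (H : Set ℝ) (r : ℝ → SchwartzMap (Space n) ℂ) : Prop :=
  ∀ k l N : ℕ, ∃ C : ℝ, ∀ h ∈ H, SchwartzMap.seminorm ℝ k l (r h) ≤ C * h ^ N

/-- `u = O_{L²}(1)`. -/
def IsBoundedL2 {n : ℕ} (H : Set ℝ) (u : ℝ → Space n → ℂ) : Prop :=
  ∃ C : ℝ, ∀ h ∈ H, MeasureTheory.MemLp (u h) 2 MeasureTheory.volume ∧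
    MeasureTheory.eLpNorm (u h) 2 MeasureTheory.volume ≤ ENNReal.ofReal C

/-- The family `u`, bounded in `L²`, is localized in phase space by the cutoff `χ`:
`u(h) = χ(x,hD) u(h) + O_𝓢(h^∞)`. -/
structure IsLocalizedBy {n : ℕ} (H : Set ℝ) (χ : ℝ → Phase n → ℂ) (u : ℝ → Space n → ℂ) :
    Prop where
  cutoff : IsCutoff H χ
  bounded : IsBoundedL2 H u
  localized : ∃ r : ℝ → SchwartzMap (Space n) ℂ, IsNegligible H r ∧
    ∀ h ∈ H, QuantizationEq h (χ h) (u h) (fun x => u h x - r h x)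

/-- `a(x,hD) u = O_{L²}(h)`. -/
def IsApproximateSolution {n : ℕ} (H : Set ℝ) (a : ℝ → Phase n → ℂ) (u : ℝ → Space n → ℂ) :
    Prop :=
  ∃ C : ℝ, ∀ h ∈ H, ∃ f : Space n → ℂ, MeasureTheory.MemLp f 2 MeasureTheory.volume ∧
    QuantizationEq h (a h) (u h) f ∧
    MeasureTheory.eLpNorm f 2 MeasureTheory.volume ≤ ENNReal.ofReal (C * h)

end Semiclassical

namespace Semiclassical

open MeasureTheory SchwartzMap FourierTransform

/-! Since `p` is elliptic on the support of `χ`, the symbol `b = χ / p` is smooth with compact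
support, and `b(x,hD)` inverts `P` on the support of `χ` up to `O(h)`. Hence `u = b(x,hD) P u` up to
errors of size `h`, and `Pu = O(h)` forces `u = O(h)` in `L²`. The kernels live at scale `h`, so the
passage from `L²` to `L^∞` costs `h^{-n/2}`, and the remaining exponents follow by interpolation.

No operator calculus or `L²` boundedness theorem is needed: the composition is carried out on one
row of the kernel at a time. For fixed `x`, the row of the kernel of `b(x,hD)` is a Schwartz
function `φ(y) = h⁻ⁿ B((x - y)/h)`, where `B` has Fourier transform `b(x,·)`. Applying the transpose
of `a(x,hD)` to `φ` produces the amplitude `a(x - hs, ξ)` integrated against `B(s)`. Freezing it at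
`s = 0` gives the symbol `a b = χ + h Y`, where `Y = b (a - p)/h`; the increment `a(x - hs, ξ) -
a(x, ξ)` contributes a rapidly decaying kernel of size `h` (`norm_incrementKernel_le`). Thus the row
of `χ(x,hD)` differs from the transpose applied to `φ` by `O(h)` times the integrable weight at
scale `h` (`exists_norm_quantizationTranspose_sub_le`).

Testing `Pu = f` against `φ` and using the localization of `u` bounds `|u|` pointwise by a
convolution of `|f| + h|u|` with the weight, plus a negligible term (`exists_enorm_le_lintegral`).
Schur's test gives the `L²` bound, Cauchy–Schwarz the `L^∞` bound
(`exists_lintegral_sq_le_and_enorm_le`), and `eLpNorm_le_of_lintegral_sq_le` interpolates. -/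

lemma continuous_inv_one_add_norm_pow {V : Type*} [NormedAddCommGroup V] (J : ℕ) :
    Continuous fun s : V => ((1 + ‖s‖) ^ J)⁻¹ := by
  refine Continuous.inv₀ (by fun_prop) fun s => ?_
  positivity

/-! ### Bounded families of Schwartz functions and their Fourier integrals -/

section

variable {ι V : Type*} [NormedAddCommGroup V] [InnerProductSpace ℝ V]

/-- A family of Schwartz functions that is bounded in the Schwartz space. -/
def IsBoundedSchwartz (g : ι → 𝓢(V, ℂ)) : Prop :=
  ∀ k l : ℕ, ∃ C : ℝ, ∀ i, SchwartzMap.seminorm ℝ k l (g i) ≤ C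

/-- Continuous linear maps preserve von Neumann bounded sets. This makes every later use of the
Fourier transform uniform in the parameter. -/
lemma IsBoundedSchwartz.map {g : ι → 𝓢(V, ℂ)} (hg : IsBoundedSchwartz g)
    (T : 𝓢(V, ℂ) →L[ℝ] 𝓢(V, ℂ)) : IsBoundedSchwartz fun i => T (g i) := by
  have hS := schwartz_withSeminorms ℝ V ℂ
  have hb : Bornology.IsVonNBounded ℝ (Set.range g) := by
    rw [hS.isVonNBounded_iff_seminorm_bounded]
    rintro ⟨k, l⟩
    obtain ⟨C, hC⟩ := hg k l
    refine ⟨|C| + 1, by positivity, ?_⟩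
    rintro _ ⟨i, rfl⟩
    exact ((hC i).trans (le_abs_self C)).trans_lt (lt_add_one _)
  have hT := (hS.isVonNBounded_iff_seminorm_bounded).1 (hb.image T)
  intro k l
  obtain ⟨r, -, hr⟩ := hT (k, l)
  exact ⟨r, fun i => (hr _ ⟨g i, ⟨i, rfl⟩, rfl⟩).le⟩

lemma one_add_pow_le {t : ℝ} (ht : 0 ≤ t) (J : ℕ) : (1 + t) ^ J ≤ 2 ^ J * (1 + t ^ J) := by
  have := add_pow_le (zero_le_one' ℝ) ht J
  rw [one_pow] at this
  refine this.trans ?_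
  gcongr
  · norm_num
  · omega

lemma IsBoundedSchwartz.decay {g : ι → 𝓢(V, ℂ)} (hg : IsBoundedSchwartz g) (l J : ℕ) :
    ∃ C : ℝ, 0 ≤ C ∧ ∀ i s, ‖iteratedFDeriv ℝ l (g i) s‖ ≤ C * ((1 + ‖s‖) ^ J)⁻¹ := by
  obtain ⟨C₀, h₀⟩ := hg 0 l
  obtain ⟨C₁, h₁⟩ := hg J l
  refine ⟨2 ^ J * (|C₀| + |C₁|), by positivity, fun i s => ?_⟩
  rw [← div_eq_mul_inv, le_div_iff₀ (by positivity), mul_comm]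
  have e₀ := (g i).le_seminorm ℝ 0 l s
  have e₁ := (g i).le_seminorm ℝ J l s
  rw [pow_zero, one_mul] at e₀
  calc (1 + ‖s‖) ^ J * ‖iteratedFDeriv ℝ l (g i) s‖
      ≤ 2 ^ J * (1 + ‖s‖ ^ J) * ‖iteratedFDeriv ℝ l (g i) s‖ := by
        gcongr; exact one_add_pow_le (norm_nonneg s) J
    _ = 2 ^ J * (‖iteratedFDeriv ℝ l (g i) s‖ + ‖s‖ ^ J * ‖iteratedFDeriv ℝ l (g i) s‖) := by ring
    _ ≤ 2 ^ J * (|C₀| + |C₁|) := by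
        gcongr
        · exact e₀.trans ((h₀ i).trans (le_abs_self _))
        · exact e₁.trans ((h₁ i).trans (le_abs_self _))

lemma IsBoundedSchwartz.norm_le {g : ι → 𝓢(V, ℂ)} (hg : IsBoundedSchwartz g) (J : ℕ) :
    ∃ C : ℝ, 0 ≤ C ∧ ∀ i s, ‖g i s‖ ≤ C * ((1 + ‖s‖) ^ J)⁻¹ := by
  obtain ⟨C, h0, hC⟩ := hg.decay 0 J
  exact ⟨C, h0, fun i s => by simpa using hC i s⟩

/-- Uniformly bounded smooth functions supported in a fixed ball form a bounded family of Schwartz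
functions. -/
lemma exists_isBoundedSchwartz [FiniteDimensional ℝ V] {g : ι → V → ℂ} {R : ℝ}
    (hg : ∀ i, ContDiff ℝ ∞ (g i)) (hR : ∀ i, tsupport (g i) ⊆ Metric.closedBall 0 R)
    (hb : ∀ k : ℕ, ∃ C : ℝ, ∀ i s, ‖iteratedFDeriv ℝ k (g i) s‖ ≤ C) :
    ∃ G : ι → 𝓢(V, ℂ), (∀ i, ⇑(G i) = g i) ∧ IsBoundedSchwartz G := by
  have hc : ∀ i, HasCompactSupport (g i) := fun i =>
    (isCompact_closedBall (0 : V) R).of_isClosed_subset (isClosed_tsupport _) (hR i)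
  refine ⟨fun i => (hc i).toSchwartzMap (hg i), fun i => rfl, fun k l => ?_⟩
  obtain ⟨C, hC⟩ := hb l
  refine ⟨|R| ^ k * |C|, fun i => ?_⟩
  refine SchwartzMap.seminorm_le_bound ℝ k l _ (by positivity) fun s => ?_
  change ‖s‖ ^ k * ‖iteratedFDeriv ℝ l (g i) s‖ ≤ _
  by_cases hs : s ∈ tsupport (g i)
  · have h1 : ‖s‖ ≤ |R| := (by simpa using hR i hs : ‖s‖ ≤ R).trans (le_abs_self R)
    have h2 := (hC i s).trans (le_abs_self C)
    gcongr
  · have : iteratedFDeriv ℝ l (g i) s = 0 := by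
      by_contra h
      exact hs (support_iteratedFDeriv_subset (𝕜 := ℝ) l h)
    rw [this, norm_zero, mul_zero]
    positivity

/-- The plane wave `e^{i⟨w,ξ⟩}`. -/
noncomputable def planeWave (w ξ : V) : ℂ := Complex.exp (Complex.I * ((inner ℝ w ξ : ℝ) : ℂ))

@[simp] lemma norm_planeWave (w ξ : V) : ‖planeWave w ξ‖ = 1 := by
  rw [planeWave, mul_comm, Complex.norm_exp_ofReal_mul_I]

lemma planeWave_add (v w ξ : V) : planeWave (v + w) ξ = planeWave v ξ * planeWave w ξ := by
  rw [planeWave, planeWave, planeWave, ← Complex.exp_add, inner_add_left]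
  push_cast
  ring_nf

lemma continuous_planeWave : Continuous fun z : V × V => planeWave z.1 z.2 := by
  unfold planeWave
  fun_prop

lemma continuous_planeWave_right (w : V) : Continuous (planeWave w) :=
  continuous_planeWave.comp (Continuous.prodMk_right w)

lemma hasDerivAt_planeWave (w ξ e : V) (t : ℝ) :
    HasDerivAt (fun t : ℝ => planeWave w (ξ + t • e))
      (Complex.I * (inner ℝ w e : ℝ) * planeWave w (ξ + t • e)) t := by
  have h1 : HasDerivAt (fun t : ℝ => (inner ℝ w (ξ + t • e) : ℝ)) (inner ℝ w e) t := by
    have : (fun t : ℝ => (inner ℝ w (ξ + t • e) : ℝ)) =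
        fun t => inner ℝ w ξ + t * inner ℝ w e := by
      funext t; rw [inner_add_right, inner_smul_right]
    rw [this]
    simpa using ((hasDerivAt_id t).mul_const (inner ℝ w e)).const_add (inner ℝ w ξ)
  have h2 := (h1.ofReal_comp.const_mul Complex.I).cexp
  refine h2.congr_deriv ?_
  rw [planeWave]
  ring

variable [FiniteDimensional ℝ V] [MeasurableSpace V] [BorelSpace V]

lemma integrable_inv_one_add_norm_pow {J : ℕ} (hJ : Module.finrank ℝ V < J) :
    Integrable fun s : V => ((1 + ‖s‖) ^ J)⁻¹ := by
  have := integrable_one_add_norm (E := V) (μ := volume) (r := J) (by exact_mod_cast hJ)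
  refine this.congr (Filter.Eventually.of_forall fun s => ?_)
  simp only
  rw [Real.rpow_neg (by positivity), Real.rpow_natCast]

/-- Converts the semiclassical phase `e^{i⟨w,ξ⟩}` to the normalization `e^{-2πi⟨·,·⟩}` of `𝓕`,
whence the dilation by `-(2π)⁻¹`. -/
lemma integral_planeWave_mul (g : V → ℂ) (w : V) :
    ∫ ξ, planeWave w ξ * g ξ = 𝓕 g (-((2 * Real.pi)⁻¹ • w)) := by
  rw [Real.fourier_eq']
  congr 1
  funext ξ
  rw [smul_eq_mul, planeWave, inner_neg_right, inner_smul_right, real_inner_comm]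
  have : -2 * Real.pi * -((2 * Real.pi)⁻¹ * inner ℝ ξ w) = inner ℝ ξ w := by
    field_simp
  rw [this, mul_comm Complex.I]

lemma IsBoundedSchwartz.norm_integral_planeWave_le {g : ι → 𝓢(V, ℂ)} (hg : IsBoundedSchwartz g)
    (J : ℕ) : ∃ C : ℝ, 0 ≤ C ∧
      ∀ i (w : V), ‖∫ ξ, planeWave w ξ * g i ξ‖ ≤ C * ((1 + ‖w‖) ^ J)⁻¹ := by
  obtain ⟨C, h0, hC⟩ := (hg.map (fourierCLM ℝ 𝓢(V, ℂ))).norm_le J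
  refine ⟨C * (2 * Real.pi) ^ J, by positivity, fun i w => ?_⟩
  rw [integral_planeWave_mul, ← fourier_coe]
  refine (hC i _).trans ?_
  have hpi := Real.pi_gt_three
  have h1 : 1 + ‖w‖ ≤ 2 * Real.pi * (1 + ‖-((2 * Real.pi)⁻¹ • w)‖) := by
    rw [norm_neg, norm_smul, Real.norm_of_nonneg (by positivity), mul_add, ← mul_assoc,
      mul_inv_cancel₀ (by positivity)]
    linarith
  have h2 : (1 + ‖w‖) ^ J ≤ (2 * Real.pi) ^ J * (1 + ‖-((2 * Real.pi)⁻¹ • w)‖) ^ J := by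
    rw [← mul_pow]; gcongr
  rw [mul_assoc]
  gcongr
  rw [← div_eq_mul_inv, le_div_iff₀ (by positivity), mul_comm, ← div_eq_mul_inv,
    div_le_iff₀ (by positivity)]
  exact h2

/-- Every bounded family of Schwartz functions consists of the Fourier transforms of a bounded
family of Schwartz functions. -/
lemma IsBoundedSchwartz.exists_integral_planeWave_eq {g : ι → 𝓢(V, ℂ)}
    (hg : IsBoundedSchwartz g) : ∃ B : ι → 𝓢(V, ℂ), IsBoundedSchwartz B ∧
      ∀ i (ξ : V), ∫ s, planeWave (-s) ξ * B i s = g i ξ := by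
  let D : V ≃L[ℝ] V :=
    ContinuousLinearEquiv.smulLeft (Units.mk0 (2 * Real.pi) (by positivity) : ℝˣ)
  have hD : ∀ v, D v = (2 * Real.pi) • v := fun v => rfl
  refine ⟨fun i => 𝓕⁻ (compCLMOfContinuousLinearEquiv ℝ D (g i)),
    (hg.map (compCLMOfContinuousLinearEquiv ℝ D)).map (fourierInvCLM ℝ 𝓢(V, ℂ)), fun i ξ => ?_⟩
  have h1 : ∀ s : V, planeWave (-s) ξ = planeWave (-ξ) s := fun s => by
    simp only [planeWave, inner_neg_left, real_inner_comm]
  simp_rw [h1]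
  rw [integral_planeWave_mul, ← fourier_coe, FourierTransform.fourier_fourierInv_eq]
  simp only [compCLMOfContinuousLinearEquiv_apply, Function.comp_apply, hD, smul_neg, neg_neg]
  rw [smul_smul, mul_inv_cancel₀ (by positivity), one_smul]

end

lemma norm_iteratedFDeriv_comp_affine_le {E F G : Type*} [NormedAddCommGroup E] [NormedSpace ℝ E]
    [NormedAddCommGroup F] [NormedSpace ℝ F] [NormedAddCommGroup G] [NormedSpace ℝ G]
    {f : F → G} (hf : ContDiff ℝ ∞ f) (L : E →L[ℝ] F) (c : F) (k : ℕ) (s : E) :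
    ‖iteratedFDeriv ℝ k (fun s => f (L s + c)) s‖ ≤
      ‖iteratedFDeriv ℝ k f (L s + c)‖ * ‖L‖ ^ k := by
  have h1 : ContDiff ℝ ∞ fun z => f (z + c) := hf.comp (contDiff_id.add contDiff_const)
  have h2 := L.iteratedFDeriv_comp_right h1 s (i := k) (mod_cast le_top)
  rw [iteratedFDeriv_comp_add_right] at h2
  change ‖iteratedFDeriv ℝ k ((fun z => f (z + c)) ∘ L) s‖ ≤ _
  rw [h2]
  refine (ContinuousMultilinearMap.norm_compContinuousLinearMap_le _ _).trans ?_
  simp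

/-! ### Increments of amplitudes in the position variable -/

section

variable {ι V : Type*} [NormedAddCommGroup V] [InnerProductSpace ℝ V]

/-- A family of smooth functions all of whose derivatives are bounded, uniformly in the family, by
a fixed power of `(1 + ‖x‖)(1 + ‖ξ‖)`. -/
structure IsAmplitude (N : ℕ) (q : ι → V × V → ℂ) : Prop where
  smooth : ∀ i, ContDiff ℝ ∞ (q i)
  bound : ∀ k : ℕ, ∃ C : ℝ, 0 ≤ C ∧ ∀ i x ξ,
    ‖iteratedFDeriv ℝ k (q i) (x, ξ)‖ ≤ C * ((1 + ‖x‖) * (1 + ‖ξ‖)) ^ N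

/-- The derivative in the second variable, in the direction `e`. -/
noncomputable def verticalDeriv (e : V) (q : ι → V × V → ℂ) (i : ι) (z : V × V) : ℂ :=
  fderiv ℝ (q i) z (0, e)

lemma IsAmplitude.verticalDeriv {N : ℕ} {q : ι → V × V → ℂ} (hq : IsAmplitude N q) (e : V) :
    IsAmplitude N (verticalDeriv e q) where
  smooth i := ((hq.smooth i).fderiv_right (m := ∞) (by simp)).clm_apply contDiff_const
  bound k := by
    obtain ⟨C, h0, hC⟩ := hq.bound (k + 1)
    refine ⟨‖((0 : V), e)‖ * C, by positivity, fun i x ξ => ?_⟩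
    have h1 : ContDiff ℝ ∞ (fderiv ℝ (q i)) := (hq.smooth i).fderiv_right (by simp)
    refine (norm_iteratedFDeriv_clm_apply_const (n := k) h1.contDiffAt (mod_cast le_top)).trans ?_
    rw [norm_iteratedFDeriv_fderiv, mul_assoc]
    gcongr
    exact hC i x ξ

/-- The increment `q(x - hs, ξ) - q(x, ξ)`. -/
def increment (q : ι → V × V → ℂ) (x : ι → V) (h : ι → ℝ) (i : ι) (ξ s : V) : ℂ :=
  q i (x i - h i • s, ξ) - q i (x i, ξ)

variable {q : ι → V × V → ℂ} {x : ι → V} {h : ι → ℝ} {R : ℝ} {N : ℕ} {B : ι → 𝓢(V, ℂ)}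

lemma contDiff_increment (hq : IsAmplitude N q) (i : ι) (ξ : V) :
    ContDiff ℝ ∞ (increment q x h i ξ) := by
  unfold increment
  refine ((hq.smooth i).comp ?_).sub contDiff_const
  exact (contDiff_const.sub (contDiff_id.const_smul _)).prodMk contDiff_const

lemma continuous_increment (hq : IsAmplitude N q) (i : ι) :
    Continuous fun z : V × V => increment q x h i z.1 z.2 := by
  have := (hq.smooth i).continuous
  unfold increment
  fun_prop

/-- Every order of differentiation in `s` retains one factor `h`: order zero by the mean value
inequality over a step of length `h‖s‖`, higher orders by the chain rule. The extra power of `1 +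
‖s‖` is that step length. -/
lemma norm_iteratedFDeriv_increment_le (hq : IsAmplitude N q) (hR : 0 ≤ R) (hx : ∀ i, ‖x i‖ ≤ R)
    (h0 : ∀ i, 0 < h i) (h1 : ∀ i, h i ≤ 1) (l : ℕ) :
    ∃ C : ℝ, 0 ≤ C ∧ ∀ i ξ s, ‖iteratedFDeriv ℝ l (increment q x h i ξ) s‖ ≤
      C * h i * ((1 + ‖s‖) ^ (N + 1) * (1 + ‖ξ‖) ^ N) := by
  have hy : ∀ s : V, 1 + (R + ‖s‖) ≤ (1 + R) * (1 + ‖s‖) := fun s => by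
    nlinarith [mul_nonneg hR (norm_nonneg s)]
  have key : ∀ (i : ι) (s : V), ‖x i - h i • s‖ ≤ R + ‖s‖ := fun i s => by
    refine (norm_sub_le _ _).trans (add_le_add (hx i) ?_)
    rw [norm_smul, Real.norm_of_nonneg (h0 i).le]
    exact mul_le_of_le_one_left (norm_nonneg s) (h1 i)
  rcases l with _ | l
  · obtain ⟨C, hC0, hC⟩ := hq.bound 1
    refine ⟨C * (1 + R) ^ N, by positivity, fun i ξ s => ?_⟩
    rw [norm_iteratedFDeriv_zero]
    -- The frequency stays fixed along the segment, so the growth in `ξ` is that of the endpoint.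
    have hconv : Convex ℝ (Metric.closedBall (0 : V) (R + ‖s‖) ×ˢ ({ξ} : Set V)) :=
      (convex_closedBall _ _).prod (convex_singleton _)
    have hb : ∀ z ∈ Metric.closedBall (0 : V) (R + ‖s‖) ×ˢ ({ξ} : Set V),
        ‖fderiv ℝ (q i) z‖ ≤ C * ((1 + R) * (1 + ‖s‖) * (1 + ‖ξ‖)) ^ N := by
      rintro ⟨y, η⟩ ⟨hy1, hη⟩
      have hη' : η = ξ := hη
      subst hη'
      have hy2 : ‖y‖ ≤ R + ‖s‖ := by simpa using hy1
      rw [← norm_iteratedFDeriv_one]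
      refine (hC i y η).trans ?_
      gcongr
      exact (add_le_add_right hy2 1).trans (hy s)
    have hmem0 : (x i, ξ) ∈ Metric.closedBall (0 : V) (R + ‖s‖) ×ˢ ({ξ} : Set V) := by
      refine ⟨?_, rfl⟩
      simpa using (hx i).trans (le_add_of_nonneg_right (norm_nonneg s))
    have hmem1 : (x i - h i • s, ξ) ∈ Metric.closedBall (0 : V) (R + ‖s‖) ×ˢ ({ξ} : Set V) := by
      refine ⟨?_, rfl⟩
      simpa using key i s
    have hmv := hconv.norm_image_sub_le_of_norm_fderiv_le (𝕜 := ℝ) (f := q i)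
      (fun z _ => (hq.smooth i).differentiable (by simp) z) hb hmem0 hmem1
    refine hmv.trans ?_
    have e1 : ‖((x i - h i • s, ξ) : V × V) - (x i, ξ)‖ = h i * ‖s‖ := by
      simp [Prod.norm_def, norm_smul, abs_of_pos (h0 i), (h0 i).le, mul_nonneg]
    rw [e1]
    have e2 : ‖s‖ ≤ 1 + ‖s‖ := by linarith
    have hh := (h0 i).le
    calc C * ((1 + R) * (1 + ‖s‖) * (1 + ‖ξ‖)) ^ N * (h i * ‖s‖)
        ≤ C * ((1 + R) * (1 + ‖s‖) * (1 + ‖ξ‖)) ^ N * (h i * (1 + ‖s‖)) := by gcongr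
      _ = _ := by simp only [mul_pow]; ring
  · obtain ⟨C, hC0, hC⟩ := hq.bound (l + 1)
    refine ⟨C * (1 + R) ^ N, by positivity, fun i ξ s => ?_⟩
    let L : V →L[ℝ] V × V := (-h i) • ContinuousLinearMap.inl ℝ V V
    have hL : ‖L‖ ≤ h i := by
      refine (ContinuousLinearMap.opNorm_smul_le _ _).trans ?_
      rw [norm_neg, Real.norm_of_nonneg (h0 i).le]
      exact mul_le_of_le_one_right (h0 i).le (ContinuousLinearMap.norm_inl_le_one ℝ V V)
    have hLs : ∀ s, L s + (x i, ξ) = (x i - h i • s, ξ) := fun s => by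
      simp [L, sub_eq_add_neg, add_comm]
    have e0 : ‖iteratedFDeriv ℝ (l + 1) (increment q x h i ξ) s‖ =
        ‖iteratedFDeriv ℝ (l + 1) (fun s => q i (L s + (x i, ξ))) s‖ := by
      -- One derivative removes the subtracted constant `q(x, ξ)`.
      rw [← norm_iteratedFDeriv_fderiv, ← norm_iteratedFDeriv_fderiv]
      congr 2
      funext s
      simp only [hLs]
      unfold increment
      rw [fderiv_sub_const]
    rw [e0]
    refine (norm_iteratedFDeriv_comp_affine_le (hq.smooth i) L _ _ _).trans ?_
    rw [hLs]
    have hhl : ‖L‖ ^ (l + 1) ≤ h i := by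
      calc ‖L‖ ^ (l + 1) ≤ h i ^ (l + 1) := by gcongr
        _ ≤ h i := pow_le_of_le_one (h0 i).le (h1 i) (Nat.succ_ne_zero l)
    have hh := (h0 i).le
    calc _ ≤ C * ((1 + ‖x i - h i • s‖) * (1 + ‖ξ‖)) ^ N * h i := by
          gcongr
          exact hC i _ ξ
      _ ≤ C * ((1 + R) * (1 + ‖s‖) * (1 + ‖ξ‖)) ^ N * h i := by
          gcongr
          exact (add_le_add_right (key i s) 1).trans (hy s)
      _ = C * (1 + R) ^ N * h i * ((1 + ‖s‖) ^ N * (1 + ‖ξ‖) ^ N) := by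
          simp only [mul_pow]; ring
      _ ≤ _ := by
          gcongr
          · linarith [norm_nonneg s]
          · omega

lemma norm_iteratedFDeriv_increment_mul_le (hq : IsAmplitude N q) (hR : 0 ≤ R)
    (hx : ∀ i, ‖x i‖ ≤ R) (h0 : ∀ i, 0 < h i) (h1 : ∀ i, h i ≤ 1) (hB : IsBoundedSchwartz B)
    (l J : ℕ) :
    ∃ C : ℝ, 0 ≤ C ∧ ∀ i ξ s,
      ‖iteratedFDeriv ℝ l (fun s => increment q x h i ξ s * B i s) s‖ ≤
      C * h i * (1 + ‖ξ‖) ^ N * ((1 + ‖s‖) ^ J)⁻¹ := by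
  choose A hA0 hA using norm_iteratedFDeriv_increment_le hq hR hx h0 h1
  -- The first `N + 1` powers pay for the growth of the increment in `s`; `J` powers remain.
  choose D hD0 hD using fun l => hB.decay l (N + 1 + J)
  refine ⟨∑ k ∈ Finset.range (l + 1), (l.choose k : ℝ) * A k * D (l - k),
    Finset.sum_nonneg fun k _ => by have := hA0 k; have := hD0 (l - k); positivity,
    fun i ξ s => ?_⟩
  refine (norm_iteratedFDeriv_mul_le (contDiff_increment hq i ξ) ((B i).smooth ⊤) s
    (n := l) (mod_cast le_top)).trans ?_
  simp only [Finset.sum_mul]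
  refine Finset.sum_le_sum fun k _ => ?_
  have hh := (h0 i).le
  have := hA0 k
  have := hD0 (l - k)
  calc _ ≤ (l.choose k : ℝ) * (A k * h i * ((1 + ‖s‖) ^ (N + 1) * (1 + ‖ξ‖) ^ N)) *
        (D (l - k) * ((1 + ‖s‖) ^ (N + 1 + J))⁻¹) := by
        gcongr
        · exact hA k i ξ s
        · exact hD (l - k) i s
    _ = _ := by
        rw [pow_add (1 + ‖s‖) (N + 1) J]
        field_simp

lemma planeWave_neg_comm (s ξ : V) : planeWave (-s) ξ = planeWave (-ξ) s := by
  simp only [planeWave, inner_neg_left, real_inner_comm]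

variable [FiniteDimensional ℝ V] [MeasurableSpace V] [BorelSpace V]

variable (V) in
/-- A smooth function with `K` integrable derivatives has a Fourier transform that decays like the
power `-K`. -/
lemma norm_integral_planeWave_neg_mul_le (K : ℕ) :
    ∃ C : ℝ, 0 ≤ C ∧ ∀ (Ψ : V → ℂ) (M : ℝ), ContDiff ℝ ∞ Ψ →
      (∀ l ≤ K, ∀ s, ‖iteratedFDeriv ℝ l Ψ s‖ ≤
        M * ((1 + ‖s‖) ^ (Module.finrank ℝ V + 1))⁻¹) →
      ∀ ξ, (1 + ‖ξ‖) ^ K * ‖∫ s, planeWave (-s) ξ * Ψ s‖ ≤ C * M := by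
  set W : V → ℝ := fun s => ((1 + ‖s‖) ^ (Module.finrank ℝ V + 1))⁻¹ with hW
  have hWi : Integrable W := integrable_inv_one_add_norm_pow (Nat.lt_succ_self _)
  have hI0 : 0 ≤ ∫ s, W s := integral_nonneg fun s => by simp only [hW, Pi.zero_apply]; positivity
  refine ⟨(2 * Real.pi) ^ K * (2 ^ K * ((∫ s, W s) +
    2 ^ K * ((K + 1) * ∫ s, W s))), by positivity, fun Ψ M hΨ hM ξ => ?_⟩
  have hint : ∀ l ≤ K, Integrable fun s => ‖iteratedFDeriv ℝ l Ψ s‖ := fun l hl =>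
    (hWi.const_mul M).mono' ((hΨ.continuous_iteratedFDeriv (mod_cast le_top)).norm.aestronglyMeasurable)
      (Filter.Eventually.of_forall fun s => by simpa using hM l hl s)
  have hle : ∀ l ≤ K, ∫ s, ‖iteratedFDeriv ℝ l Ψ s‖ ≤ M * ∫ s, W s := fun l hl => by
    rw [← integral_const_mul]
    exact integral_mono (hint l hl) (hWi.const_mul M) fun s => hM l hl s
  have hM0 : 0 ≤ M := by
    have := (norm_nonneg _).trans (hM 0 (Nat.zero_le _) 0)
    simpa using this
  simp_rw [planeWave_neg_comm]
  rw [integral_planeWave_mul, smul_neg, neg_neg]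
  set η := (2 * Real.pi)⁻¹ • ξ with hη
  have hpi := Real.pi_gt_three
  have e1 : 1 + ‖ξ‖ ≤ 2 * Real.pi * (1 + ‖η‖) := by
    rw [hη, norm_smul, Real.norm_of_nonneg (by positivity), mul_add, ← mul_assoc,
      mul_inv_cancel₀ (by positivity)]
    linarith
  have e2 : ‖𝓕 Ψ η‖ ≤ M * ∫ s, W s := by
    have := hle 0 (Nat.zero_le _)
    simp only [norm_iteratedFDeriv_zero] at this
    exact (VectorFourier.norm_fourierIntegral_le_integral_norm _ _ _ _ _).trans this
  have e3 : ‖η‖ ^ K * ‖𝓕 Ψ η‖ ≤ 2 ^ K * ((K + 1) * (M * ∫ s, W s)) := by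
    have := Real.pow_mul_norm_iteratedFDeriv_fourier_le (K := 0) (N := (K : ℕ∞)) (f := Ψ)
      (hΨ.of_le (mod_cast le_top)) (fun k n hk hn => by
        have hk0 : k = 0 := by simpa using hk
        subst hk0
        simpa using hint n (by exact_mod_cast hn)) (k := 0) (n := K) (by simp) le_rfl η
    rw [norm_iteratedFDeriv_zero] at this
    refine this.trans ?_
    simp only [pow_zero, one_mul, Nat.cast_zero, mul_zero, zero_add]
    gcongr
    rw [Finset.sum_product]
    simp only [Finset.range_one, Finset.sum_singleton, pow_zero, one_mul]
    refine (Finset.sum_le_card_nsmul _ _ (M * ∫ s, W s) fun l hl => ?_).trans ?_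
    · exact hle l (Nat.lt_succ_iff.1 (Finset.mem_range.1 hl))
    · simp
  calc (1 + ‖ξ‖) ^ K * ‖𝓕 Ψ η‖ ≤ (2 * Real.pi * (1 + ‖η‖)) ^ K * ‖𝓕 Ψ η‖ := by gcongr
    _ = (2 * Real.pi) ^ K * ((1 + ‖η‖) ^ K * ‖𝓕 Ψ η‖) := by rw [mul_pow, mul_assoc]
    _ ≤ (2 * Real.pi) ^ K * ((2 ^ K * (1 + ‖η‖ ^ K)) * ‖𝓕 Ψ η‖) := by
        gcongr; exact one_add_pow_le (norm_nonneg η) K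
    _ = (2 * Real.pi) ^ K * (2 ^ K * (‖𝓕 Ψ η‖ + ‖η‖ ^ K * ‖𝓕 Ψ η‖)) := by ring
    _ ≤ (2 * Real.pi) ^ K * (2 ^ K * ((M * ∫ s, W s) + 2 ^ K * ((K + 1) * (M * ∫ s, W s)))) := by
        gcongr
    _ = _ := by ring

end

/-! ### The increment kernel: size `h` and rapid decay -/

section

variable {ι V : Type*} [NormedAddCommGroup V] [InnerProductSpace ℝ V]
  {q : ι → V × V → ℂ} {x : ι → V} {h : ι → ℝ} {R : ℝ} {N : ℕ} {B : ι → 𝓢(V, ℂ)}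

/-- Multiplication by `s ↦ -i⟨s,e⟩` on Schwartz functions. -/
noncomputable def mulInner (e : V) : 𝓢(V, ℂ) →L[ℝ] 𝓢(V, ℂ) :=
  (smulLeftCLM ℂ fun s : V => -(Complex.I * ((inner ℝ s e : ℝ) : ℂ))).restrictScalars ℝ

lemma mulInner_apply (e : V) (f : 𝓢(V, ℂ)) (s : V) :
    mulInner e f s = -(Complex.I * ((inner ℝ s e : ℝ) : ℂ)) * f s := by
  have : Function.HasTemperateGrowth fun s : V => -(Complex.I * ((inner ℝ s e : ℝ) : ℂ)) := by
    have h1 : Function.HasTemperateGrowth fun s : V => (inner ℝ e s : ℝ) :=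
      (innerSL ℝ e).hasTemperateGrowth
    have h2 : Function.HasTemperateGrowth fun s : V => (((inner ℝ s e : ℝ)) : ℂ) := by
      simp_rw [real_inner_comm e]
      fun_prop
    fun_prop
  rw [mulInner, ContinuousLinearMap.coe_restrictScalars', smulLeftCLM_apply_apply this, smul_eq_mul]

lemma continuous_incrementSymbol_integrand (hq : IsAmplitude N q) (i : ι) :
    Continuous fun z : V × V => planeWave (-z.2) z.1 * (increment q x h i z.1 z.2 * B i z.2) := by
  have h1 : Continuous fun z : V × V => planeWave (-z.2) z.1 :=
    continuous_planeWave.comp (continuous_snd.neg.prodMk continuous_fst)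
  exact h1.mul ((continuous_increment hq i).mul ((B i).continuous.comp continuous_snd))

lemma hasDerivAt_increment (hq : IsAmplitude N q) (i : ι) (ξ s e : V) (t : ℝ) :
    HasDerivAt (fun t : ℝ => increment q x h i (ξ + t • e) s)
      (increment (verticalDeriv e q) x h i (ξ + t • e) s) t := by
  have key : ∀ y : V, HasDerivAt (fun t : ℝ => q i (y, ξ + t • e))
      (verticalDeriv e q i (y, ξ + t • e)) t := fun y => by
    have h1 : HasFDerivAt (q i) (fderiv ℝ (q i) (y, ξ + t • e)) (y, ξ + t • e) :=
      ((hq.smooth i).differentiable (by simp) _).hasFDerivAt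
    have h2 : HasDerivAt (fun t : ℝ => ξ + t • e) e t := by
      simpa using ((hasDerivAt_id t).smul_const e).const_add ξ
    have h3 : HasDerivAt (fun t : ℝ => (y, ξ + t • e)) ((0 : V), e) t :=
      (hasDerivAt_const t y).prodMk h2
    exact h1.comp_hasDerivAt t h3
  exact (key _).sub (key _)

/-- Reduces decay in `‖w‖` to decay in each coordinate, which integration by parts in one direction
supplies. -/
lemma norm_pow_le_sum_inner [FiniteDimensional ℝ V] (w : V) (J : ℕ) :
    ‖w‖ ^ (J + 1) ≤ (Module.finrank ℝ V : ℝ) ^ J *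
      ∑ j, |(inner ℝ w (stdOrthonormalBasis ℝ V j) : ℝ)| ^ (J + 1) := by
  have e1 : ‖w‖ ≤ ∑ j, |(inner ℝ w (stdOrthonormalBasis ℝ V j) : ℝ)| := by
    conv_lhs => rw [← (stdOrthonormalBasis ℝ V).sum_repr' w]
    refine (norm_sum_le _ _).trans (Finset.sum_le_sum fun j _ => ?_)
    rw [norm_smul, OrthonormalBasis.norm_eq_one, mul_one, Real.norm_eq_abs, real_inner_comm]
  have e3 := pow_sum_le_card_mul_sum_pow (s := Finset.univ)
    (f := fun j => |(inner ℝ w (stdOrthonormalBasis ℝ V j) : ℝ)|) (fun j _ => abs_nonneg _) J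
  simp only [Finset.card_univ, Fintype.card_fin] at e3
  exact (pow_le_pow_left₀ (norm_nonneg w) e1 _).trans e3

variable [FiniteDimensional ℝ V] [MeasurableSpace V] [BorelSpace V]

/-- The symbol `∫ e^{-i⟨s,ξ⟩} (q(x - hs, ξ) - q(x, ξ)) B(s) ds`. -/
noncomputable def incrementSymbol (q : ι → V × V → ℂ) (B : ι → 𝓢(V, ℂ)) (x : ι → V) (h : ι → ℝ)
    (i : ι) (ξ : V) : ℂ :=
  ∫ s, planeWave (-s) ξ * (increment q x h i ξ s * B i s)

/-- The kernel with symbol `incrementSymbol`. -/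
noncomputable def incrementKernel (q : ι → V × V → ℂ) (B : ι → 𝓢(V, ℂ)) (x : ι → V) (h : ι → ℝ)
    (i : ι) (w : V) : ℂ :=
  ∫ ξ, planeWave w ξ * incrementSymbol q B x h i ξ

lemma stronglyMeasurable_incrementSymbol (hq : IsAmplitude N q) (i : ι) :
    StronglyMeasurable (incrementSymbol q B x h i) :=
  StronglyMeasurable.integral_prod_right
    (f := fun ξ s => planeWave (-s) ξ * (increment q x h i ξ s * B i s))
    (continuous_incrementSymbol_integrand hq i).stronglyMeasurable

/-- The integral is a Fourier transform in `s` of a smooth decaying function, so it decays to any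
order in `ξ`. Order `N + L` is used: `N` powers cancel the growth of the amplitude and `L` are left.
-/
lemma norm_incrementSymbol_le (hq : IsAmplitude N q) (hR : 0 ≤ R)
    (hx : ∀ i, ‖x i‖ ≤ R) (h0 : ∀ i, 0 < h i) (h1 : ∀ i, h i ≤ 1) (hB : IsBoundedSchwartz B)
    (L : ℕ) : ∃ C : ℝ, 0 ≤ C ∧ ∀ i ξ,
      ‖incrementSymbol q B x h i ξ‖ ≤ C * h i * ((1 + ‖ξ‖) ^ L)⁻¹ := by
  obtain ⟨C, hC0, hC⟩ := norm_integral_planeWave_neg_mul_le V (N + L)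
  choose A hA0 hA using fun l => norm_iteratedFDeriv_increment_mul_le hq hR hx h0 h1 hB l
    (Module.finrank ℝ V + 1)
  set M := ∑ l ∈ Finset.range (N + L + 1), A l with hM
  have hM0 : 0 ≤ M := Finset.sum_nonneg fun l _ => hA0 l
  refine ⟨C * M, by positivity, fun i ξ => ?_⟩
  have hh := (h0 i).le
  have key := hC (fun s => increment q x h i ξ s * B i s) (M * h i * (1 + ‖ξ‖) ^ N)
    ((contDiff_increment hq i ξ).mul ((B i).smooth ⊤)) (fun l hl s => by
      refine (hA l i ξ s).trans ?_
      gcongr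
      exact Finset.single_le_sum (f := A) (fun l _ => hA0 l)
        (Finset.mem_range.2 (Nat.lt_succ_of_le hl))) ξ
  rw [← div_eq_mul_inv, le_div_iff₀ (by positivity)]
  rw [pow_add] at key
  have hp : 0 < (1 + ‖ξ‖) ^ N := by positivity
  refine le_of_mul_le_mul_left ?_ hp
  calc _ = (1 + ‖ξ‖) ^ N * (1 + ‖ξ‖) ^ L * ‖incrementSymbol q B x h i ξ‖ := by ring
    _ ≤ C * (M * h i * (1 + ‖ξ‖) ^ N) := key
    _ = _ := by ring

lemma integrable_incrementSymbol (hq : IsAmplitude N q) (hR : 0 ≤ R)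
    (hx : ∀ i, ‖x i‖ ≤ R) (h0 : ∀ i, 0 < h i) (h1 : ∀ i, h i ≤ 1) (hB : IsBoundedSchwartz B)
    (i : ι) : Integrable (incrementSymbol q B x h i) := by
  obtain ⟨C, hC0, hC⟩ := norm_incrementSymbol_le hq hR hx h0 h1 hB (Module.finrank ℝ V + 1)
  exact ((integrable_inv_one_add_norm_pow (Nat.lt_succ_self _)).const_mul (C * h i)).mono'
    (stronglyMeasurable_incrementSymbol hq i).aestronglyMeasurable
    (Filter.Eventually.of_forall (hC i))

lemma integrable_planeWave_mul {f : V → ℂ} (hf : Integrable f) (w : V) :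
    Integrable fun ξ => planeWave w ξ * f ξ :=
  hf.bdd_mul (c := 1) (continuous_planeWave_right w).aestronglyMeasurable
    (Filter.Eventually.of_forall fun ξ => (norm_planeWave w ξ).le)

/-- A derivative in `ξ` falls on the amplitude or on the phase, the latter multiplying `B` by
`-i⟨s,e⟩`. Both terms are increment symbols of the same class, which lets the decay argument be
iterated. -/
lemma hasLineDerivAt_incrementSymbol (hq : IsAmplitude N q) (hR : 0 ≤ R)
    (hx : ∀ i, ‖x i‖ ≤ R) (h0 : ∀ i, 0 < h i) (h1 : ∀ i, h i ≤ 1) (hB : IsBoundedSchwartz B)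
    (e : V) (i : ι) (ξ : V) :
    HasLineDerivAt ℝ (incrementSymbol q B x h i)
      (incrementSymbol (verticalDeriv e q) B x h i ξ +
        incrementSymbol q (fun i => mulInner e (B i)) x h i ξ) ξ e := by
  have hq' := hq.verticalDeriv e
  have hB' := hB.map (mulInner e)
  set J := Module.finrank ℝ V + 1 with hJ
  have hWi : Integrable fun s : V => ((1 + ‖s‖) ^ J)⁻¹ :=
    integrable_inv_one_add_norm_pow (Nat.lt_succ_self _)
  obtain ⟨C₁, hC₁0, hC₁⟩ := norm_iteratedFDeriv_increment_mul_le hq' hR hx h0 h1 hB 0 J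
  obtain ⟨C₂, hC₂0, hC₂⟩ := norm_iteratedFDeriv_increment_mul_le hq hR hx h0 h1 hB' 0 J
  obtain ⟨C₃, hC₃0, hC₃⟩ := norm_iteratedFDeriv_increment_mul_le hq hR hx h0 h1 hB 0 J
  simp only [norm_iteratedFDeriv_zero] at hC₁ hC₂ hC₃
  have hh := (h0 i).le
  have hcont : ∀ {q' : ι → V × V → ℂ} {B' : ι → 𝓢(V, ℂ)} (_ : IsAmplitude N q') (η : V),
      Continuous fun s => planeWave (-s) η * (increment q' x h i η s * B' i s) :=
    fun hq' η => (continuous_incrementSymbol_integrand hq' i).comp (Continuous.prodMk_right η)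
  have hint : ∀ {q' : ι → V × V → ℂ} {B' : ι → 𝓢(V, ℂ)} {C : ℝ} (_ : IsAmplitude N q')
      (_ : ∀ i ξ s, ‖increment q' x h i ξ s * B' i s‖ ≤
        C * h i * (1 + ‖ξ‖) ^ N * ((1 + ‖s‖) ^ J)⁻¹) (η : V),
      Integrable fun s => planeWave (-s) η * (increment q' x h i η s * B' i s) := by
    intro q' B' C hq' hC η
    refine (hWi.const_mul (C * h i * (1 + ‖η‖) ^ N)).mono' (hcont hq' η).aestronglyMeasurable
      (Filter.Eventually.of_forall fun s => ?_)
    rw [norm_mul, norm_planeWave, one_mul]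
    exact hC i η s
  have main := hasDerivAt_integral_of_dominated_loc_of_deriv_le (μ := (volume : Measure V))
    (F := fun (t : ℝ) s => planeWave (-s) (ξ + t • e) *
      (increment q x h i (ξ + t • e) s * B i s))
    (F' := fun (t : ℝ) s => planeWave (-s) (ξ + t • e) *
        (increment (verticalDeriv e q) x h i (ξ + t • e) s * B i s) +
      planeWave (-s) (ξ + t • e) *
        (increment q x h i (ξ + t • e) s * mulInner e (B i) s))
    (bound := fun s => (C₁ + C₂) * h i * (1 + (‖ξ‖ + ‖e‖)) ^ N * ((1 + ‖s‖) ^ J)⁻¹)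
    (x₀ := 0) (s := Metric.ball 0 1) (Metric.ball_mem_nhds _ one_pos)
    (Filter.Eventually.of_forall fun t => (hcont hq _).aestronglyMeasurable)
    (hint hq hC₃ _)
    ((hcont hq' _).add (hcont (B' := fun i => mulInner e (B i)) hq _)).aestronglyMeasurable
    (Filter.Eventually.of_forall fun s t ht => ?_)
    (hWi.const_mul _)
    (Filter.Eventually.of_forall fun s t _ => ?_)
  · have h2 := main.2
    simp only [zero_smul, add_zero] at h2
    rw [integral_add (hint hq' hC₁ ξ) (hint (B' := fun i => mulInner e (B i)) hq hC₂ ξ)] at h2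
    exact h2
  · have ht1 : |t| ≤ 1 := by simpa using (Metric.mem_ball.1 ht).le
    have h3 : ‖ξ + t • e‖ ≤ ‖ξ‖ + ‖e‖ := by
      refine (norm_add_le _ _).trans (add_le_add_right ?_ _)
      rw [norm_smul, Real.norm_eq_abs]
      exact mul_le_of_le_one_left (norm_nonneg e) ht1
    refine (norm_add_le _ _).trans ?_
    rw [norm_mul, norm_mul (planeWave (-s) (ξ + t • e)), norm_planeWave, one_mul, one_mul]
    refine (add_le_add (hC₁ i _ s) (hC₂ i _ s)).trans ?_
    rw [← add_mul, ← add_mul, ← add_mul]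
    gcongr
  · have h4 := (hasDerivAt_planeWave (-s) ξ e t).mul
      ((hasDerivAt_increment (x := x) (h := h) hq i ξ s e t).mul_const (B i s))
    refine h4.congr_deriv ?_
    rw [mulInner_apply, inner_neg_left]
    push_cast
    ring

/-- Integration by parts in `ξ`: the factor `i⟨w,e⟩` is a derivative of the plane wave, which is
moved onto the symbol. -/
lemma inner_mul_incrementKernel (hq : IsAmplitude N q) (hR : 0 ≤ R)
    (hx : ∀ i, ‖x i‖ ≤ R) (h0 : ∀ i, 0 < h i) (h1 : ∀ i, h i ≤ 1) (hB : IsBoundedSchwartz B)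
    (e : V) (i : ι) (w : V) :
    Complex.I * (inner ℝ w e : ℝ) * incrementKernel q B x h i w =
      -(incrementKernel (verticalDeriv e q) B x h i w +
        incrementKernel q (fun i => mulInner e (B i)) x h i w) := by
  have hq' := hq.verticalDeriv e
  have hB' := hB.map (mulInner e)
  have I0 := integrable_incrementSymbol hq hR hx h0 h1 hB i
  have I1 := integrable_incrementSymbol hq' hR hx h0 h1 hB i
  have I2 := integrable_incrementSymbol hq hR hx h0 h1 hB' i
  have hw : ∀ ξ : V, HasLineDerivAt ℝ (planeWave w)
      (Complex.I * (inner ℝ w e : ℝ) * planeWave w ξ) ξ e := fun ξ => by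
    have := hasDerivAt_planeWave w ξ e 0
    simpa [HasLineDerivAt] using this
  have parts := integral_bilinear_hasLineDerivAt_right_eq_neg_left_of_integrable
    (μ := (volume : Measure V)) (B := ContinuousLinearMap.mul ℝ ℂ) (v := e)
    (f := incrementSymbol q B x h i)
    (f' := fun ξ => incrementSymbol (verticalDeriv e q) B x h i ξ +
        incrementSymbol q (fun i => mulInner e (B i)) x h i ξ)
    (g := planeWave w) (g' := fun ξ => Complex.I * (inner ℝ w e : ℝ) * planeWave w ξ)
    ?_ ?_ ?_ (fun ξ _ => hasLineDerivAt_incrementSymbol hq hR hx h0 h1 hB e i ξ)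
    (fun ξ _ => hw ξ)
  · simp only [ContinuousLinearMap.mul_apply'] at parts
    unfold incrementKernel
    rw [← integral_add (integrable_planeWave_mul I1 w) (integrable_planeWave_mul I2 w),
      ← integral_const_mul]
    calc _ = ∫ ξ, incrementSymbol q B x h i ξ *
          (Complex.I * (inner ℝ w e : ℝ) * planeWave w ξ) := by
          congr 1; funext ξ; ring
      _ = _ := by
          rw [parts]; congr 2; funext ξ; ring
  · simp only [ContinuousLinearMap.mul_apply']
    exact (integrable_planeWave_mul (I1.add I2) w).congr
      (Filter.Eventually.of_forall fun ξ => mul_comm _ _)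
  · simp only [ContinuousLinearMap.mul_apply']
    exact ((integrable_planeWave_mul I0 w).const_mul (Complex.I * (inner ℝ w e : ℝ))).congr
      (Filter.Eventually.of_forall fun ξ => by simp only; ring)
  · simp only [ContinuousLinearMap.mul_apply']
    exact (integrable_planeWave_mul I0 w).congr
      (Filter.Eventually.of_forall fun ξ => mul_comm _ _)

/-- Each factor `⟨w,e⟩` is traded for two kernels of the same class, so the induction must quantify
over all `q` and `B`. The case of no factors integrates the symbol bound. -/
lemma abs_inner_pow_mul_norm_incrementKernel_le (hR : 0 ≤ R) (hx : ∀ i, ‖x i‖ ≤ R)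
    (h0 : ∀ i, 0 < h i) (h1 : ∀ i, h i ≤ 1) (e : V) (M : ℕ) (hq : IsAmplitude N q)
    (hB : IsBoundedSchwartz B) :
    ∃ C : ℝ, 0 ≤ C ∧ ∀ i w,
      |(inner ℝ w e : ℝ)| ^ M * ‖incrementKernel q B x h i w‖ ≤ C * h i := by
  induction M generalizing q B with
  | zero =>
    obtain ⟨C, hC0, hC⟩ := norm_incrementSymbol_le hq hR hx h0 h1 hB (Module.finrank ℝ V + 1)
    have hWi : Integrable fun s : V => ((1 + ‖s‖) ^ (Module.finrank ℝ V + 1))⁻¹ :=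
      integrable_inv_one_add_norm_pow (Nat.lt_succ_self _)
    refine ⟨C * ∫ s : V, ((1 + ‖s‖) ^ (Module.finrank ℝ V + 1))⁻¹,
      mul_nonneg hC0 (integral_nonneg fun s => by simp only [Pi.zero_apply]; positivity),
      fun i w => ?_⟩
    rw [pow_zero, one_mul]
    refine (norm_integral_le_of_norm_le (hWi.const_mul (C * h i))
      (Filter.Eventually.of_forall fun ξ => ?_)).trans_eq ?_
    · rw [norm_mul, norm_planeWave, one_mul]
      exact hC i ξ
    · rw [integral_const_mul]; ring
  | succ M ih =>
    obtain ⟨C₁, hC₁0, hC₁⟩ := ih (hq.verticalDeriv e) hB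
    obtain ⟨C₂, hC₂0, hC₂⟩ := ih hq (hB.map (mulInner e))
    refine ⟨C₁ + C₂, by positivity, fun i w => ?_⟩
    have key := congrArg norm (inner_mul_incrementKernel hq hR hx h0 h1 hB e i w)
    rw [norm_mul, norm_mul, Complex.norm_I, one_mul, Complex.norm_real, Real.norm_eq_abs,
      norm_neg] at key
    rw [pow_succ, mul_assoc, key, add_mul]
    refine (mul_le_mul_of_nonneg_left (norm_add_le _ _) (by positivity)).trans ?_
    rw [mul_add]
    exact add_le_add (hC₁ i w) (hC₂ i w)

/-- The kernel of the increment is `O(h)` and decays rapidly. -/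
lemma norm_incrementKernel_le (hq : IsAmplitude N q) (hR : 0 ≤ R)
    (hx : ∀ i, ‖x i‖ ≤ R) (h0 : ∀ i, 0 < h i) (h1 : ∀ i, h i ≤ 1) (hB : IsBoundedSchwartz B)
    (J : ℕ) : ∃ C : ℝ, 0 ≤ C ∧ ∀ i w,
      ‖incrementKernel q B x h i w‖ ≤ C * h i * ((1 + ‖w‖) ^ (J + 1))⁻¹ := by
  obtain ⟨C, hC0, hC⟩ := abs_inner_pow_mul_norm_incrementKernel_le hR hx h0 h1 0 0 hq hB
  choose D hD0 hD using fun j => abs_inner_pow_mul_norm_incrementKernel_le hR hx h0 h1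
    (stdOrthonormalBasis ℝ V j) (J + 1) hq hB
  have hDs : 0 ≤ ∑ j, D j := Finset.sum_nonneg fun j _ => hD0 j
  refine ⟨2 ^ (J + 1) * (C + (Module.finrank ℝ V : ℝ) ^ J * ∑ j, D j), by positivity,
    fun i w => ?_⟩
  rw [← div_eq_mul_inv, le_div_iff₀ (by positivity), mul_comm]
  set K := ‖incrementKernel q B x h i w‖
  have hK : 0 ≤ K := norm_nonneg _
  have e0 : K ≤ C * h i := by simpa using hC i w
  calc (1 + ‖w‖) ^ (J + 1) * K ≤ 2 ^ (J + 1) * (1 + ‖w‖ ^ (J + 1)) * K := by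
        gcongr; exact one_add_pow_le (norm_nonneg w) _
    _ ≤ 2 ^ (J + 1) * (1 + (Module.finrank ℝ V : ℝ) ^ J *
          ∑ j, |(inner ℝ w (stdOrthonormalBasis ℝ V j) : ℝ)| ^ (J + 1)) * K := by
        gcongr; exact norm_pow_le_sum_inner w J
    _ = 2 ^ (J + 1) * (K + (Module.finrank ℝ V : ℝ) ^ J *
          ∑ j, |(inner ℝ w (stdOrthonormalBasis ℝ V j) : ℝ)| ^ (J + 1) * K) := by
        rw [← Finset.sum_mul]; ring
    _ ≤ 2 ^ (J + 1) * (C * h i + (Module.finrank ℝ V : ℝ) ^ J * ∑ j, D j * h i) := by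
        gcongr 2 ^ (J + 1) * (?_ + _ * ?_)
        exact Finset.sum_le_sum fun j _ => hD j i w
    _ = _ := by rw [← Finset.sum_mul]; ring

end

/-! ### Compactly supported symbols and division by an elliptic symbol -/

section

variable {κ E : Type*} [NormedAddCommGroup E] [NormedSpace ℝ E]

/-- A family of smooth functions supported in a fixed ball, with uniformly bounded derivatives. -/
structure IsBump (R : ℝ) (b : κ → E → ℂ) : Prop where
  smooth : ∀ i, ContDiff ℝ ∞ (b i)
  support : ∀ i, tsupport (b i) ⊆ Metric.closedBall 0 R
  bound : ∀ k : ℕ, ∃ C : ℝ, 0 ≤ C ∧ ∀ i z, ‖iteratedFDeriv ℝ k (b i) z‖ ≤ C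

lemma iteratedFDeriv_eq_zero_of_notMem_tsupport {f : E → ℂ} {z : E} (hz : z ∉ tsupport f) (k : ℕ) :
    iteratedFDeriv ℝ k f z = 0 := by
  by_contra h
  exact hz (support_iteratedFDeriv_subset (𝕜 := ℝ) k h)

/-- The second factor need be smooth only near the support of the first, with derivatives bounded
there; this accommodates `1 / p`, which is uncontrolled elsewhere. -/
lemma IsBump.mul {R : ℝ} {b g : κ → E → ℂ} {U : κ → Set E} (hb : IsBump R b)
    (hU : ∀ i, IsOpen (U i)) (hbU : ∀ i, tsupport (b i) ⊆ U i)
    (hg : ∀ i, ContDiffOn ℝ ∞ (g i) (U i))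
    (hgb : ∀ k : ℕ, ∃ C : ℝ, 0 ≤ C ∧
      ∀ i, ∀ z ∈ tsupport (b i), ‖iteratedFDeriv ℝ k (g i) z‖ ≤ C) :
    IsBump R fun i z => b i z * g i z where
  smooth i := by
    refine contDiff_iff_contDiffAt.2 fun z => ?_
    by_cases hz : z ∈ tsupport (b i)
    · exact (hb.smooth i).contDiffAt.mul ((hg i).contDiffAt ((hU i).mem_nhds (hbU i hz)))
    · refine (contDiffAt_const (c := (0 : ℂ))).congr_of_eventuallyEq ?_
      filter_upwards [notMem_tsupport_iff_eventuallyEq.1 hz] with y hy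
      rw [hy, Pi.zero_apply, zero_mul]
  support i := tsupport_mul_subset_left.trans (hb.support i)
  bound k := by
    choose A hA0 hA using hb.bound
    choose D hD0 hD using hgb
    have hs : 0 ≤ ∑ l ∈ Finset.range (k + 1), (k.choose l : ℝ) * A l * D (k - l) :=
      Finset.sum_nonneg fun l _ => by have := hA0 l; have := hD0 (k - l); positivity
    refine ⟨_, hs, fun i z => ?_⟩
    by_cases hz : z ∈ tsupport (b i)
    · have hzU := hbU i hz
      have key := norm_iteratedFDerivWithin_mul_le ((hb.smooth i).contDiffOn (s := U i)) (hg i)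
        (hU i).uniqueDiffOn hzU (n := k) (mod_cast le_top)
      rw [iteratedFDerivWithin_of_isOpen k (hU i) hzU] at key
      refine key.trans (Finset.sum_le_sum fun l _ => ?_)
      rw [iteratedFDerivWithin_of_isOpen l (hU i) hzU,
        iteratedFDerivWithin_of_isOpen (k - l) (hU i) hzU]
      have := hA0 l
      gcongr
      · exact hA l i z
      · exact hD (k - l) i z hz
    · have hz' : z ∉ tsupport fun z => b i z * g i z := fun h => hz (tsupport_mul_subset_left h)
      rw [iteratedFDeriv_eq_zero_of_notMem_tsupport hz', norm_zero]
      exact hs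

/-- The derivatives of `1 / p` are bounded where `p` is bounded below and has bounded
derivatives. -/
lemma exists_norm_iteratedFDeriv_inv_le {p : κ → E → ℂ} {S : κ → Set E} {c : ℝ} (hc : 0 < c)
    (hp : ∀ i, ContDiff ℝ ∞ (p i)) (hpc : ∀ i, ∀ z ∈ S i, c ≤ ‖p i z‖)
    (hpb : ∀ k : ℕ, ∃ C : ℝ, 0 ≤ C ∧ ∀ i, ∀ z ∈ S i, ‖iteratedFDeriv ℝ k (p i) z‖ ≤ C) (k : ℕ) :
    ∃ C : ℝ, 0 ≤ C ∧
      ∀ i, ∀ z ∈ S i, ‖iteratedFDeriv ℝ k (fun z => (p i z)⁻¹) z‖ ≤ C := by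
  choose A hA0 hA using hpb
  have ho : IsOpen ({0}ᶜ : Set ℂ) := isOpen_compl_singleton
  have hinv : ContDiffOn ℝ ∞ (fun w : ℂ => w⁻¹) {0}ᶜ := fun w hw =>
    (contDiffAt_inv ℝ hw).contDiffWithinAt
  -- All values of `p` on `S` lie in this compact annulus avoiding `0`, on which the derivatives of
  -- inversion are bounded.
  let Q : Set ℂ := Metric.closedBall 0 (A 0) ∩ {w | c ≤ ‖w‖}
  have hQ : IsCompact Q :=
    (isCompact_closedBall _ _).inter_right (isClosed_le continuous_const continuous_norm)
  have hQ0 : Q ⊆ {0}ᶜ := by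
    rintro w ⟨-, hw⟩ rfl
    have : c ≤ ‖(0 : ℂ)‖ := hw
    rw [norm_zero] at this
    linarith
  have hbd : ∀ l : ℕ, ∃ M : ℝ, ∀ w ∈ Q,
      ‖iteratedFDerivWithin ℝ l (fun w : ℂ => w⁻¹) {0}ᶜ w‖ ≤ M := fun l =>
    hQ.exists_bound_of_continuousOn
      ((hinv.continuousOn_iteratedFDerivWithin (mod_cast le_top) ho.uniqueDiffOn).mono hQ0)
  choose M hM using hbd
  set M' := ∑ l ∈ Finset.range (k + 1), |M l| with hM'
  -- The Faà di Bruno estimate wants the `l`-th derivative bounded by `D ^ l`; the summand `1`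
  -- ensures `D ≤ D ^ l` for `l ≥ 1`.
  set D := 1 + ∑ l ∈ Finset.range (k + 1), A l with hD
  have hM0 : 0 ≤ M' := Finset.sum_nonneg fun l _ => abs_nonneg _
  have hD1 : 1 ≤ D := le_add_of_nonneg_right (Finset.sum_nonneg fun l _ => hA0 l)
  refine ⟨k.factorial * M' * D ^ k, by positivity, fun i z hz => ?_⟩
  have hz0 : p i z ∈ ({0}ᶜ : Set ℂ) := by
    have := hc.trans_le (hpc i z hz)
    simpa using norm_pos_iff.1 this
  have hoU : IsOpen (p i ⁻¹' {0}ᶜ) := ho.preimage (hp i).continuous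
  have key := norm_iteratedFDerivWithin_comp_le (n := k) (x := z) (C := M') (D := D) hinv
    ((hp i).contDiffOn (s := p i ⁻¹' {0}ᶜ)) (mod_cast le_top) ho.uniqueDiffOn hoU.uniqueDiffOn
    (Set.mapsTo_preimage _ _) hz0 (fun l hl => ?_) (fun l hl1 hl => ?_)
  · rwa [iteratedFDerivWithin_of_isOpen k hoU hz0] at key
  · refine (hM l _ ⟨?_, hpc i z hz⟩).trans ((le_abs_self _).trans ?_)
    · simpa using hA 0 i z hz
    · exact Finset.single_le_sum (f := fun l => |M l|) (fun l _ => abs_nonneg _)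
        (Finset.mem_range.2 (Nat.lt_succ_of_le hl))
  · rw [iteratedFDerivWithin_of_isOpen l hoU hz0]
    refine (hA l i z hz).trans (le_trans ?_ (le_self_pow₀ hD1 (by omega)))
    refine (Finset.single_le_sum (f := A) (fun l _ => hA0 l)
        (Finset.mem_range.2 (Nat.lt_succ_of_le hl))).trans ?_
    rw [hD]
    linarith

end

/-- Freezing the position cannot enlarge derivatives or the frequency support, so the seminorms are
uniform in the arbitrary base points `x i`. -/
lemma IsBump.exists_slice {ι V : Type*} [NormedAddCommGroup V] [InnerProductSpace ℝ V]
    [FiniteDimensional ℝ V] {R : ℝ} {b : ι → V × V → ℂ} (hb : IsBump R b) (x : ι → V) :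
    ∃ G : ι → 𝓢(V, ℂ), (∀ i ξ, G i ξ = b i (x i, ξ)) ∧ IsBoundedSchwartz G := by
  have hL : ∀ ξ, ContinuousLinearMap.inr ℝ V V ξ = (0, ξ) := fun ξ => rfl
  have hsupp : ∀ i, tsupport (fun ξ => b i (x i, ξ)) ⊆ Metric.closedBall 0 R := fun i => by
    refine closure_minimal (fun ξ hξ => ?_) Metric.isClosed_closedBall
    have h1 := hb.support i (subset_tsupport _ hξ)
    rw [mem_closedBall_zero_iff] at h1 ⊢
    exact (le_max_right _ _).trans h1
  have hbd : ∀ k : ℕ, ∃ C : ℝ, ∀ i ξ,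
      ‖iteratedFDeriv ℝ k (fun ξ => b i (x i, ξ)) ξ‖ ≤ C := fun k => by
    obtain ⟨C, hC0, hC⟩ := hb.bound k
    refine ⟨C, fun i ξ => ?_⟩
    have h1 := norm_iteratedFDeriv_comp_affine_le (hb.smooth i) (ContinuousLinearMap.inr ℝ V V)
      (x i, 0) k ξ
    simp only [hL, Prod.mk_add_mk, zero_add, add_zero] at h1
    refine h1.trans ?_
    have h2 : ‖ContinuousLinearMap.inr ℝ V V‖ ^ k ≤ 1 :=
      pow_le_one₀ (ContinuousLinearMap.opNorm_nonneg _) (ContinuousLinearMap.norm_inr_le_one ℝ V V)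
    exact (mul_le_of_le_one_right (norm_nonneg _) h2).trans (hC i _)
  obtain ⟨G, hG, hGb⟩ := exists_isBoundedSchwartz
    (fun i => (hb.smooth i).comp (contDiff_const.prodMk contDiff_id)) hsupp hbd
  exact ⟨G, fun i ξ => by rw [hG]; rfl, hGb⟩

lemma IsOrderFunction.exists_le {n : ℕ} {m : Phase n → ℝ} (hm : IsOrderFunction m) :
    ∃ (C : ℝ) (N : ℕ), 0 ≤ C ∧ ∀ x ξ, m (x, ξ) ≤ C * ((1 + ‖x‖) * (1 + ‖ξ‖)) ^ N := by
  obtain ⟨C, N, hC⟩ := hm.growth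
  have h0 := hm.nonneg (0, 0)
  refine ⟨|C| * m (0, 0), N, by positivity, fun x ξ => (hC x ξ 0 0).trans ?_⟩
  rw [sub_zero, sub_zero]
  have h1 : 1 + ‖x‖ + ‖ξ‖ ≤ (1 + ‖x‖) * (1 + ‖ξ‖) := by
    nlinarith [mul_nonneg (norm_nonneg x) (norm_nonneg ξ)]
  calc C * (1 + ‖x‖ + ‖ξ‖) ^ N * m (0, 0) ≤ |C| * ((1 + ‖x‖) * (1 + ‖ξ‖)) ^ N * m (0, 0) := by
        gcongr
        exact le_abs_self C
    _ = _ := by ring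

lemma IsSymbol.isAmplitude {n : ℕ} {H : Set ℝ} {m : Phase n → ℝ} {a : ℝ → Phase n → ℂ}
    (ha : IsSymbol H m a) {C₀ : ℝ} {N : ℕ} (hC₀ : 0 ≤ C₀) (hm0 : ∀ z, 0 ≤ m z)
    (hm : ∀ x ξ, m (x, ξ) ≤ C₀ * ((1 + ‖x‖) * (1 + ‖ξ‖)) ^ N) {ι : Type*} {h : ι → ℝ}
    (hh : ∀ i, h i ∈ H) : IsAmplitude N fun i => a (h i) where
  smooth i := ha.smooth _ (hh i)
  bound k := by
    obtain ⟨C, hC⟩ := ha.bound k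
    refine ⟨|C| * C₀, by positivity, fun i x ξ => (hC _ (hh i) _).trans ?_⟩
    rw [mul_assoc]
    have := hm0 (x, ξ)
    gcongr
    · exact le_abs_self C
    · exact hm x ξ

lemma IsAmplitude.bound_ball {ι V : Type*} [NormedAddCommGroup V] [InnerProductSpace ℝ V]
    {N : ℕ} {q : ι → V × V → ℂ} (hq : IsAmplitude N q) {R : ℝ} (hR : 0 ≤ R) {S : ι → Set (V × V)}
    (hS : ∀ i, S i ⊆ Metric.closedBall 0 R) (k : ℕ) :
    ∃ C : ℝ, 0 ≤ C ∧ ∀ i, ∀ z ∈ S i, ‖iteratedFDeriv ℝ k (q i) z‖ ≤ C := by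
  obtain ⟨C, hC0, hC⟩ := hq.bound k
  refine ⟨C * ((1 + R) * (1 + R)) ^ N, by positivity, fun i z hz => ?_⟩
  have h1 : ‖z‖ ≤ R := by simpa using hS i hz
  have h2 : ‖z.1‖ ≤ R := (le_max_left _ _).trans h1
  have h3 : ‖z.2‖ ≤ R := (le_max_right _ _).trans h1
  refine (hC i z.1 z.2).trans ?_
  gcongr

/-! ### Kernels at scale `h` and the rescaled transpose -/

/-- The kernel of the left quantization of a compactly supported symbol. -/
noncomputable def quantizationKernel {n : ℕ} (h : ℝ) (χ : Phase n → ℂ) (x z : Space n) : ℂ :=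
  (((2 * Real.pi * h) ^ n : ℝ) : ℂ)⁻¹ * ∫ ξ, planeWave (h⁻¹ • (x - z)) ξ * χ (x, ξ)

/-- The integrable weight `h⁻ⁿ (1 + ‖w‖/h)⁻ⁿ⁻¹`. -/
noncomputable def weight {n : ℕ} (h : ℝ) (w : Space n) : ℝ :=
  (h ^ n)⁻¹ * ((1 + ‖h⁻¹ • w‖) ^ (n + 1))⁻¹

lemma weight_nonneg {n : ℕ} {h : ℝ} (hh : 0 < h) (w : Space n) : 0 ≤ weight h w := by
  unfold weight; positivity

lemma continuous_weight {n : ℕ} (h : ℝ) : Continuous (weight (n := n) h) :=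
  continuous_const.mul ((continuous_inv_one_add_norm_pow _).comp (continuous_const_smul _))

lemma exp_inner_div_eq_planeWave {n : ℕ} (h : ℝ) (v ξ : Space n) :
    Complex.exp (Complex.I * ((inner ℝ v ξ / h : ℝ) : ℂ)) = planeWave (h⁻¹ • v) ξ := by
  rw [planeWave, inner_smul_left]
  simp [div_eq_inv_mul]

lemma exists_rescaled {n : ℕ} {h : ℝ} (hh : 0 < h) (x : Space n) (B : 𝓢(Space n, ℂ)) :
    ∃ φ : 𝓢(Space n, ℂ), ∀ y, φ y = ((h ^ n : ℝ) : ℂ)⁻¹ * B (h⁻¹ • (x - y)) := by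
  let D : Space n ≃L[ℝ] Space n :=
    ContinuousLinearEquiv.smulLeft (Units.mk0 (-h⁻¹) (by simp [hh.ne']) : ℝˣ)
  have hD : ∀ v, D v = (-h⁻¹) • v := fun v => rfl
  refine ⟨((h ^ n : ℝ) : ℂ)⁻¹ • compSubConstCLM ℂ x (compCLMOfContinuousLinearEquiv ℂ D B),
    fun y => ?_⟩
  rw [smul_apply, compSubConstCLM_apply, compCLMOfContinuousLinearEquiv_apply,
    Function.comp_apply, hD, smul_eq_mul]
  congr 2
  rw [neg_smul, ← smul_neg, neg_sub]

lemma integral_eq_smul_integral_sub_smul {n : ℕ} {h : ℝ} (hh : 0 < h) (x : Space n)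
    (g : Space n → ℂ) : ∫ y, g y = ((h ^ n : ℝ) : ℂ) * ∫ s, g (x - h • s) := by
  rw [Measure.integral_comp_smul volume (fun y => g (x - y)) h,
    integral_sub_left_eq_self g volume x, finrank_euclideanSpace_fin, abs_of_pos (by positivity),
    Complex.real_smul, ← mul_assoc, ← Complex.ofReal_mul, mul_inv_cancel₀ (by positivity)]
  simp

/-- The substitution `y = x - hs` splits the phase into a plane wave at `(x - z)/h` and one at `-s`.
Its Jacobian cancels the normalization of `φ`, and `h` survives inside the integral only through
`a(x - hs, ξ)` and `(x - z)/h`. -/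
lemma quantizationTranspose_rescaled {n : ℕ} {h : ℝ} (hh : 0 < h) (a : Phase n → ℂ)
    {x : Space n} {φ B : Space n → ℂ} (hφ : ∀ y, φ y = ((h ^ n : ℝ) : ℂ)⁻¹ * B (h⁻¹ • (x - y)))
    (z : Space n) :
    quantizationTranspose h a φ z = (((2 * Real.pi * h) ^ n : ℝ) : ℂ)⁻¹ *
      ∫ ξ, planeWave (h⁻¹ • (x - z)) ξ * ∫ s, planeWave (-s) ξ * (a (x - h • s, ξ) * B s) := by
  unfold quantizationTranspose
  congr 2
  funext ξ
  rw [integral_eq_smul_integral_sub_smul hh x, ← integral_const_mul, ← integral_const_mul]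
  congr 1
  funext s
  have h1 : h⁻¹ • (x - h • s - z) = h⁻¹ • (x - z) + -s := by
    rw [sub_right_comm, smul_sub, smul_smul, inv_mul_cancel₀ hh.ne', one_smul, sub_eq_add_neg]
  have h2 : h⁻¹ • (x - (x - h • s)) = s := by
    rw [sub_sub_cancel, smul_smul, inv_mul_cancel₀ hh.ne', one_smul]
  have h3 : ((h ^ n : ℝ) : ℂ) ≠ 0 := by
    exact_mod_cast (pow_pos hh n).ne'
  rw [exp_inner_div_eq_planeWave, h1, planeWave_add, hφ, h2]
  field_simp

/-! ### The parametrix applied row by row -/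

section

variable {ι V : Type*} [NormedAddCommGroup V] [InnerProductSpace ℝ V]
  {q : ι → V × V → ℂ} {x : ι → V} {h : ι → ℝ} {R : ℝ} {N : ℕ} {B b X Y : ι → 𝓢(V, ℂ)}
  [FiniteDimensional ℝ V] [MeasurableSpace V] [BorelSpace V]

/-- Write `q(x - hs, ξ)` as its value at `s = 0` plus the increment. The frozen value factors out of
the `s`-integral, leaving `q b`, which splits as `X + hY`. -/
lemma integral_planeWave_composition (hq : IsAmplitude N q) (hR : 0 ≤ R)
    (hx : ∀ i, ‖x i‖ ≤ R) (h0 : ∀ i, 0 < h i) (h1 : ∀ i, h i ≤ 1) (hB : IsBoundedSchwartz B)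
    (hBb : ∀ i (ξ : V), ∫ s, planeWave (-s) ξ * B i s = b i ξ)
    (hXY : ∀ i ξ, q i (x i, ξ) * b i ξ = X i ξ + h i * Y i ξ) (i : ι) (w : V) :
    ∫ ξ, planeWave w ξ * ∫ s, planeWave (-s) ξ * (q i (x i - h i • s, ξ) * B i s) =
      incrementKernel q B x h i w + (∫ ξ, planeWave w ξ * X i ξ) +
        h i * ∫ ξ, planeWave w ξ * Y i ξ := by
  obtain ⟨C, hC0, hC⟩ := norm_iteratedFDeriv_increment_mul_le hq hR hx h0 h1 hB 0
    (Module.finrank ℝ V + 1)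
  have hpw : ∀ {f : V → ℂ} (ξ : V), Integrable f → Integrable fun s => planeWave (-s) ξ * f s :=
    fun {f} ξ hf => by
      simp_rw [planeWave_neg_comm]
      exact integrable_planeWave_mul hf _
  have inner : ∀ ξ, ∫ s, planeWave (-s) ξ * (q i (x i - h i • s, ξ) * B i s) =
      incrementSymbol q B x h i ξ + (X i ξ + h i * Y i ξ) := fun ξ => by
    have hI : Integrable fun s => increment q x h i ξ s * B i s := by
      refine ((integrable_inv_one_add_norm_pow (Nat.lt_succ_self _)).const_mul
        (C * h i * (1 + ‖ξ‖) ^ N)).mono'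
        ((contDiff_increment hq i ξ).continuous.mul (B i).continuous).aestronglyMeasurable
        (Filter.Eventually.of_forall fun s => ?_)
      simpa using hC i ξ s
    rw [← hXY, ← hBb, ← integral_const_mul, incrementSymbol,
      ← integral_add (hpw ξ hI) ((hpw ξ (B i).integrable).const_mul _)]
    congr 1
    funext s
    unfold increment
    ring
  simp_rw [inner, mul_add]
  rw [integral_add (integrable_planeWave_mul (integrable_incrementSymbol hq hR hx h0 h1 hB i) w),
    integral_add (integrable_planeWave_mul (X i).integrable w), incrementKernel, add_assoc,
    ← integral_const_mul]
  · congr 3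
    funext ξ
    ring
  · exact integrable_planeWave_mul ((Y i).integrable.const_mul _) w
  · exact (integrable_planeWave_mul (X i).integrable w).add
      (integrable_planeWave_mul ((Y i).integrable.const_mul _) w)

lemma stronglyMeasurable_integral_planeWave {f : V → ℂ} (hf : StronglyMeasurable f) :
    StronglyMeasurable fun w : V => ∫ ξ, planeWave w ξ * f ξ :=
  StronglyMeasurable.integral_prod_right (f := fun w ξ => planeWave w ξ * f ξ)
    (continuous_planeWave.stronglyMeasurable.mul (hf.comp_measurable measurable_snd))

end

lemma norm_inv_two_pi_mul_pow_le {n : ℕ} {h : ℝ} (hh : 0 < h) :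
    ‖(((2 * Real.pi * h) ^ n : ℝ) : ℂ)⁻¹‖ ≤ (h ^ n)⁻¹ := by
  have hpi := Real.pi_gt_three
  rw [norm_inv, Complex.norm_real, Real.norm_of_nonneg (by positivity)]
  gcongr
  nlinarith

section

variable {n : ℕ} {ι : Type*} {q : ι → Phase n → ℂ} {x : ι → Space n} {h : ι → ℝ} {R : ℝ} {N : ℕ}
  {b X Y : ι → 𝓢(Space n, ℂ)}

/-- This is `b(x,hD) a(x,hD) = χ(x,hD) + O(h)` for a single kernel row. The test function is the row
at `x i` of the kernel with symbol `b`; the error consists of the increment kernel and the term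
`hY`, both dominated by the weight. -/
lemma exists_norm_quantizationTranspose_sub_le (hq : IsAmplitude N q) (hR : 0 ≤ R)
    (hx : ∀ i, ‖x i‖ ≤ R) (h0 : ∀ i, 0 < h i) (h1 : ∀ i, h i ≤ 1) (hb : IsBoundedSchwartz b)
    (hY : IsBoundedSchwartz Y) {χ : ι → Phase n → ℂ} (hX : ∀ i ξ, X i ξ = χ i (x i, ξ))
    (hXY : ∀ i ξ, q i (x i, ξ) * b i ξ = X i ξ + h i * Y i ξ) :
    ∃ C : ℝ, 0 ≤ C ∧ ∀ i, ∃ φ : 𝓢(Space n, ℂ),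
      (∀ y, ‖φ y‖ ≤ C * weight (h i) (x i - y)) ∧
      (∀ z, ‖quantizationTranspose (h i) (q i) φ z - quantizationKernel (h i) (χ i) (x i) z‖ ≤
        C * h i * weight (h i) (x i - z)) ∧
      StronglyMeasurable fun z =>
        quantizationTranspose (h i) (q i) φ z - quantizationKernel (h i) (χ i) (x i) z := by
  obtain ⟨B, hB, hBb⟩ := hb.exists_integral_planeWave_eq
  obtain ⟨C₁, hC₁0, hC₁⟩ := hB.norm_le (n + 1)
  obtain ⟨C₂, hC₂0, hC₂⟩ := norm_incrementKernel_le hq hR hx h0 h1 hB n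
  obtain ⟨C₃, hC₃0, hC₃⟩ := hY.norm_integral_planeWave_le (n + 1)
  refine ⟨C₁ + (C₂ + C₃), by positivity, fun i => ?_⟩
  obtain ⟨φ, hφ⟩ := exists_rescaled (h0 i) (x i) (B i)
  have hh := (h0 i).le
  have key : ∀ z, quantizationTranspose (h i) (q i) φ z -
      quantizationKernel (h i) (χ i) (x i) z = (((2 * Real.pi * h i) ^ n : ℝ) : ℂ)⁻¹ *
        (incrementKernel q B x h i ((h i)⁻¹ • (x i - z)) +
          h i * ∫ ξ, planeWave ((h i)⁻¹ • (x i - z)) ξ * Y i ξ) := fun z => by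
    rw [quantizationTranspose_rescaled (h0 i) (q i) hφ,
      integral_planeWave_composition hq hR hx h0 h1 hB hBb hXY, quantizationKernel]
    simp_rw [hX]
    ring
  refine ⟨φ, fun y => ?_, fun z => ?_, ?_⟩
  · rw [hφ, norm_mul, norm_inv, Complex.norm_real, Real.norm_of_nonneg (by positivity), weight,
      mul_left_comm]
    gcongr
    refine (hC₁ i _).trans ?_
    gcongr
    linarith
  · rw [key, norm_mul, weight, mul_left_comm]
    have e1 := hC₂ i ((h i)⁻¹ • (x i - z))
    have e2 := hC₃ i ((h i)⁻¹ • (x i - z))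
    set W := ((1 + ‖(h i)⁻¹ • (x i - z)‖) ^ (n + 1))⁻¹ with hW
    have hW0 : 0 ≤ W := by positivity
    refine mul_le_mul (norm_inv_two_pi_mul_pow_le (h0 i)) ?_ (norm_nonneg _) (by positivity)
    calc _ ≤ C₂ * h i * W + h i * (C₃ * W) := by
          refine (norm_add_le _ _).trans (add_le_add e1 ?_)
          rw [norm_mul, Complex.norm_real, Real.norm_of_nonneg hh]
          gcongr
      _ = (C₂ + C₃) * h i * W := by ring
      _ ≤ _ := mul_le_mul_of_nonneg_right (mul_le_mul_of_nonneg_right (by linarith) hh) hW0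
  · simp_rw [key]
    have hm : Measurable fun z : Space n => (h i)⁻¹ • (x i - z) := by fun_prop
    refine StronglyMeasurable.const_mul (StronglyMeasurable.add ?_ (StronglyMeasurable.const_mul ?_ _)) _
    · exact (stronglyMeasurable_integral_planeWave
        (stronglyMeasurable_incrementSymbol hq i)).comp_measurable hm
    · exact (stronglyMeasurable_integral_planeWave
        (Y i).continuous.stronglyMeasurable).comp_measurable hm

/-- Taking the row position `y` as part of the index makes the Schwartz bounds on the slices, hence
the constant, uniform in `y`. -/
lemma exists_norm_quantizationKernel_le {χ : ι → Phase n → ℂ} (hχ : IsBump R χ)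
    (h0 : ∀ i, 0 < h i) : ∃ C : ℝ, 0 ≤ C ∧ ∀ i y z,
      ‖quantizationKernel (h i) (χ i) y z‖ ≤ C * weight (h i) (y - z) := by
  obtain ⟨G, hG, hGb⟩ := IsBump.exists_slice (ι := ι × Space n) (b := fun i => χ i.1) (R := R)
    ⟨fun i => hχ.smooth i.1, fun i => hχ.support i.1, fun k => by
      obtain ⟨C, hC0, hC⟩ := hχ.bound k
      exact ⟨C, hC0, fun i => hC i.1⟩⟩ Prod.snd
  obtain ⟨C, hC0, hC⟩ := hGb.norm_integral_planeWave_le (n + 1)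
  refine ⟨C, hC0, fun i y z => ?_⟩
  have hh := (h0 i).le
  rw [quantizationKernel, norm_mul, weight, mul_left_comm]
  refine mul_le_mul (norm_inv_two_pi_mul_pow_le (h0 i)) ?_ (norm_nonneg _) (by positivity)
  have := hC (i, y) ((h i)⁻¹ • (y - z))
  simpa only [hG] using this

end

/-! ### Pointwise representation of the localized family -/

section

variable {n : ℕ} {h : ℝ}

lemma integrable_weight (hh : 0 < h) : Integrable (weight (n := n) h) := by
  have h1 : Integrable fun s : Space n => ((1 + ‖s‖) ^ (n + 1))⁻¹ :=
    integrable_inv_one_add_norm_pow (by rw [finrank_euclideanSpace_fin]; exact Nat.lt_succ_self n)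
  exact (h1.comp_smul (inv_ne_zero hh.ne')).const_mul _

lemma weight_le (hh : 0 < h) (w : Space n) : weight h w ≤ (h ^ n)⁻¹ := by
  unfold weight
  refine mul_le_of_le_one_right (by positivity) (inv_le_one_of_one_le₀ ?_)
  exact one_le_pow₀ (by linarith [norm_nonneg (h⁻¹ • w)])

lemma memLp_weight (hh : 0 < h) (x : Space n) : MemLp (fun z => weight h (x - z)) 2 := by
  have hc : Continuous fun z : Space n => weight h (x - z) :=
    (continuous_weight h).comp (continuous_const.sub continuous_id)
  rw [memLp_two_iff_integrable_sq hc.aestronglyMeasurable]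
  refine (((integrable_weight hh).comp_sub_left x).const_mul (h ^ n)⁻¹).mono'
    (hc.pow 2).aestronglyMeasurable (Filter.Eventually.of_forall fun z => ?_)
  have h0 := weight_nonneg hh (x - z)
  rw [Real.norm_of_nonneg (by positivity), sq]
  exact mul_le_mul_of_nonneg_right (weight_le hh _) h0

lemma integrable_mul_of_norm_le_weight (hh : 0 < h) {u g : Space n → ℂ} (hu : MemLp u 2)
    (hg : AEStronglyMeasurable g) {C : ℝ} {x : Space n}
    (hC : ∀ z, ‖g z‖ ≤ C * weight h (x - z)) : Integrable fun z => u z * g z := by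
  have h1 : MemLp g 2 := (memLp_weight hh x).of_le_mul (c := C) hg
    (Filter.Eventually.of_forall fun z => by
      rw [Real.norm_of_nonneg (weight_nonneg hh _)]; exact hC z)
  exact hu.integrable_mul h1

/-- Moving the centre of the weight by a bounded amount. -/
lemma weight_sub_le (hh : 0 < h) {R : ℝ} {x : Space n} (hx : ‖x‖ ≤ R) (z : Space n) :
    weight h (x - z) ≤ (1 + h⁻¹ * R) ^ (n + 1) * weight h (0 - z) := by
  have hR : 0 ≤ R := (norm_nonneg x).trans hx
  have hi : 0 < h⁻¹ := inv_pos.2 hh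
  have key : 1 + ‖h⁻¹ • (0 - z)‖ ≤ (1 + h⁻¹ * R) * (1 + ‖h⁻¹ • (x - z)‖) := by
    have e1 : h⁻¹ • (0 - z) = h⁻¹ • (x - z) - h⁻¹ • x := by rw [← smul_sub]; congr 1; abel
    have e2 : ‖h⁻¹ • x‖ ≤ h⁻¹ * R := by
      rw [norm_smul, Real.norm_of_nonneg hi.le]; gcongr
    have e3 := norm_sub_le (h⁻¹ • (x - z)) (h⁻¹ • x)
    rw [e1]
    nlinarith [mul_nonneg (mul_nonneg hi.le hR) (norm_nonneg (h⁻¹ • (x - z)))]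
  unfold weight
  rw [mul_left_comm]
  gcongr
  rw [← div_eq_mul_inv, le_div_iff₀ (by positivity), inv_mul_le_iff₀ (by positivity), ← mul_pow,
    mul_comm]
  gcongr

variable {χ : Phase n → ℂ} {R : ℝ}

lemma stronglyMeasurable_quantizationKernel (hχ : Continuous χ) :
    StronglyMeasurable fun p : Space n × Space n => quantizationKernel h χ p.1 p.2 := by
  refine StronglyMeasurable.const_mul (StronglyMeasurable.integral_prod_right
    (f := fun (p : Space n × Space n) ξ => planeWave (h⁻¹ • (p.1 - p.2)) ξ * χ (p.1, ξ)) ?_) _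
  refine Continuous.stronglyMeasurable (Continuous.mul ?_ ?_)
  · exact continuous_planeWave.comp (f := fun p : (Space n × Space n) × Space n =>
      (h⁻¹ • (p.1.1 - p.1.2), p.2)) (by fun_prop)
  · exact hχ.comp (f := fun p : (Space n × Space n) × Space n => (p.1.1, p.2)) (by fun_prop)

lemma apply_eq_zero_of_lt_norm {V F : Type*} [NormedAddCommGroup V] [Zero F] {f : V → F}
    (hf : tsupport f ⊆ Metric.closedBall 0 R) {z : V} (hz : R < ‖z‖) : f z = 0 := by
  refine image_eq_zero_of_notMem_tsupport fun h => ?_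
  have := hf h
  rw [mem_closedBall_zero_iff] at this
  exact absurd this (not_le.2 hz)

lemma quantizationKernel_eq_zero (hR : tsupport χ ⊆ Metric.closedBall 0 R) {x : Space n}
    (hx : R < ‖x‖) (z : Space n) : quantizationKernel h χ x z = 0 := by
  have : ∀ ξ, χ (x, ξ) = 0 := fun ξ =>
    apply_eq_zero_of_lt_norm hR (hx.trans_le (le_max_left _ _))
  simp [quantizationKernel, this]

/-- Compact support of `χ` makes the double integral absolutely convergent, so Fubini applies; this
is unavailable for a general symbol `a`. -/
lemma quantizationTranspose_eq_integral_kernel (hχ : Continuous χ)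
    (hR : tsupport χ ⊆ Metric.closedBall 0 R) (φ : 𝓢(Space n, ℂ)) (z : Space n) :
    quantizationTranspose h χ φ z = ∫ x, φ x * quantizationKernel h χ x z := by
  unfold quantizationTranspose quantizationKernel
  simp_rw [exp_inner_div_eq_planeWave]
  rw [integral_integral_swap, ← integral_const_mul]
  · congr 1
    funext x
    rw [← integral_const_mul, ← integral_const_mul, ← integral_const_mul]
    congr 1
    funext ξ
    ring
  · have hc : Continuous (Function.uncurry fun (ξ x : Space n) =>
        planeWave (h⁻¹ • (x - z)) ξ * χ (x, ξ) * φ x) := by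
      refine Continuous.mul (Continuous.mul ?_ ?_) ?_
      · exact continuous_planeWave.comp
          (f := fun p : Space n × Space n => (h⁻¹ • (p.2 - z), p.1)) (by fun_prop)
      · exact hχ.comp (f := fun p : Space n × Space n => (p.2, p.1)) (by fun_prop)
      · exact φ.continuous.comp (f := fun p : Space n × Space n => p.2) (by fun_prop)
    refine hc.integrable_of_hasCompactSupport (HasCompactSupport.intro
      (isCompact_closedBall (0 : Space n × Space n) R) fun p hp => ?_)
    have h1 : R < ‖(p.2, p.1)‖ := by
      rw [mem_closedBall_zero_iff, not_le] at hp
      rwa [Prod.norm_mk, max_comm]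
    simp only [Function.uncurry]
    rw [apply_eq_zero_of_lt_norm hR h1, mul_zero, zero_mul]

/-- A tempered-distribution identity `χ(x,hD)u = f` holds pointwise almost everywhere. -/
lemma ae_eq_integral_kernel_of_quantizationEq (hh : 0 < h) (hχ : Continuous χ)
    (hR : tsupport χ ⊆ Metric.closedBall 0 R) {C : ℝ} (hC0 : 0 ≤ C)
    (hC : ∀ y z, ‖quantizationKernel h χ y z‖ ≤ C * weight h (y - z)) {u f : Space n → ℂ}
    (hu : MemLp u 2) (hf : MemLp f 2) (huf : QuantizationEq h χ u f) :
    ∀ᵐ x, f x = ∫ z, u z * quantizationKernel h χ x z := by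
  set A := (1 + h⁻¹ * R) ^ (n + 1) with hA
  have hKm := stronglyMeasurable_quantizationKernel (h := h) hχ
  -- The kernel vanishes for `‖x‖ > R`, so all rows share one square-integrable majorant. The
  -- constant depends on `h`, which is harmless because the majorant only justifies Fubini and local
  -- integrability.
  have hKle : ∀ x z, ‖quantizationKernel h χ x z‖ ≤ C * |A| * weight h (0 - z) := fun x z => by
    have hw := weight_nonneg hh (0 - z)
    rcases le_or_gt ‖x‖ R with hx | hx
    · refine (hC x z).trans ?_
      rw [mul_assoc]
      refine mul_le_mul_of_nonneg_left ((weight_sub_le hh hx z).trans ?_) hC0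
      exact mul_le_mul_of_nonneg_right (le_abs_self _) hw
    · rw [quantizationKernel_eq_zero hR hx, norm_zero]
      positivity
  have hI : Integrable fun z => ‖u z‖ * weight h (0 - z) :=
    hu.norm.integrable_mul (memLp_weight hh 0)
  have hTm : AEStronglyMeasurable fun x => ∫ z, u z * quantizationKernel h χ x z :=
    AEStronglyMeasurable.integral_prod_right' (μ := volume) (ν := volume)
      (f := fun p : Space n × Space n => u p.2 * quantizationKernel h χ p.1 p.2)
      (hu.1.comp_snd.mul hKm.aestronglyMeasurable)
  have hTb : ∀ x, ‖∫ z, u z * quantizationKernel h χ x z‖ ≤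
      ∫ z, C * |A| * (‖u z‖ * weight h (0 - z)) := fun x => by
    refine norm_integral_le_of_norm_le (hI.const_mul _) (Filter.Eventually.of_forall fun z => ?_)
    rw [norm_mul, mul_left_comm]
    exact mul_le_mul_of_nonneg_left (hKle x z) (norm_nonneg _)
  have hTl : LocallyIntegrable fun x => ∫ z, u z * quantizationKernel h χ x z :=
    (memLp_top_of_bound hTm _ (Filter.Eventually.of_forall hTb)).locallyIntegrable le_top
  refine ae_eq_of_integral_contDiff_smul_eq (hf.locallyIntegrable (by norm_num)) hTl
    fun g hg hgc => ?_
  have hg' : HasCompactSupport fun x => (g x : ℂ) := hgc.comp_left Complex.ofReal_zero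
  let φ : 𝓢(Space n, ℂ) := hg'.toSchwartzMap (Complex.ofRealCLM.contDiff.comp hg)
  have hφ : ∀ x, φ x = (g x : ℂ) := fun x => rfl
  have e1 := huf φ
  simp_rw [quantizationTranspose_eq_integral_kernel hχ hR, ← integral_const_mul] at e1
  rw [integral_integral_swap] at e1
  · calc ∫ x, g x • f x = ∫ x, f x * φ x := by
          congr 1; funext x; rw [hφ, Complex.real_smul, mul_comm]
      _ = _ := by
          rw [e1]
          congr 1
          funext x
          rw [Complex.real_smul, ← integral_const_mul]
          congr 1
          funext z
          rw [hφ]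
          ring
  · have hb : Integrable (fun p : Space n × Space n =>
        (‖u p.1‖ * weight h (0 - p.1)) * (C * |A| * ‖φ p.2‖)) (volume.prod volume) :=
      hI.mul_prod (φ.integrable.norm.const_mul _)
    refine hb.mono' ?_ (Filter.Eventually.of_forall fun p => ?_)
    · refine hu.1.comp_fst.mul (φ.continuous.aestronglyMeasurable.comp_snd.mul ?_)
      exact (hKm.comp_measurable measurable_swap).aestronglyMeasurable
    · simp only [Function.uncurry]
      rw [norm_mul, norm_mul]
      have := hKle p.2 p.1
      calc _ ≤ ‖u p.1‖ * (‖φ p.2‖ * (C * |A| * weight h (0 - p.1))) := by gcongr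
        _ = _ := by ring

/-- The pointwise estimate behind the elliptic bound. -/
lemma enorm_integral_kernel_le (hh : 0 < h) (hχ : Continuous χ) {C : ℝ} (hC0 : 0 ≤ C)
    {a : Phase n → ℂ} {u f : Space n → ℂ} (hu : MemLp u 2) (huf : QuantizationEq h a u f)
    {x : Space n} (hK : ∀ z, ‖quantizationKernel h χ x z‖ ≤ C * weight h (x - z))
    {φ : 𝓢(Space n, ℂ)} (hφ : ∀ y, ‖φ y‖ ≤ C * weight h (x - y))
    (hd : ∀ z, ‖quantizationTranspose h a φ z - quantizationKernel h χ x z‖ ≤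
      C * h * weight h (x - z))
    (hdm : StronglyMeasurable fun z =>
      quantizationTranspose h a φ z - quantizationKernel h χ x z) :
    ‖∫ z, u z * quantizationKernel h χ x z‖ₑ ≤ ENNReal.ofReal C *
      ∫⁻ z, ENNReal.ofReal (weight h (x - z)) * (‖f z‖ₑ + ENNReal.ofReal h * ‖u z‖ₑ) := by
  have hKm : StronglyMeasurable fun z => quantizationKernel h χ x z :=
    StronglyMeasurable.comp_measurable (g := fun z => (x, z))
      (f := fun p : Space n × Space n => quantizationKernel h χ p.1 p.2)
      (stronglyMeasurable_quantizationKernel hχ) measurable_prodMk_left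
  have I1 := integrable_mul_of_norm_le_weight hh hu hKm.aestronglyMeasurable hK
  have I2 := integrable_mul_of_norm_le_weight hh hu hdm.aestronglyMeasurable hd
  -- Testing `a(x,hD)u = f` against `φ` replaces the unknown main term by `∫ f φ`; only the `O(h)`
  -- discrepancy still sees `u`.
  have e1 : ∫ z, u z * quantizationKernel h χ x z = (∫ z, f z * φ z) -
      ∫ z, u z * (quantizationTranspose h a φ z - quantizationKernel h χ x z) := by
    rw [huf φ, eq_sub_iff_add_eq, ← integral_add I1 I2]
    refine integral_congr_ae (Filter.Eventually.of_forall fun z => ?_)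
    beta_reduce
    rw [← mul_add, add_sub_cancel]
  have hE : ∀ {v : ℂ} {c : ℝ}, ‖v‖ ≤ c → ‖v‖ₑ ≤ ENNReal.ofReal c := fun {v c} hv => by
    rw [← ofReal_norm]
    exact ENNReal.ofReal_le_ofReal hv
  have hw : Measurable fun z : Space n => ENNReal.ofReal (weight h (x - z)) :=
    (((continuous_weight h).comp (continuous_const.sub continuous_id)).measurable).ennreal_ofReal
  rw [e1, ← lintegral_const_mul' _ _ ENNReal.ofReal_ne_top]
  refine (enorm_sub_le).trans ?_
  refine (add_le_add (enorm_integral_le_lintegral_enorm _)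
    (enorm_integral_le_lintegral_enorm _)).trans ?_
  rw [← lintegral_add_right' _ I2.1.enorm]
  refine lintegral_mono fun z => ?_
  simp only [enorm_mul]
  calc ‖f z‖ₑ * ‖φ z‖ₑ + ‖u z‖ₑ * ‖quantizationTranspose h a φ z - quantizationKernel h χ x z‖ₑ
      ≤ ‖f z‖ₑ * (ENNReal.ofReal C * ENNReal.ofReal (weight h (x - z))) +
        ‖u z‖ₑ * (ENNReal.ofReal C * ENNReal.ofReal h * ENNReal.ofReal (weight h (x - z))) := by
        gcongr
        · rw [← ENNReal.ofReal_mul hC0]; exact hE (hφ z)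
        · rw [← ENNReal.ofReal_mul hC0, ← ENNReal.ofReal_mul (by positivity)]; exact hE (hd z)
    _ = _ := by ring

end

/-! ### Cauchy–Schwarz and interpolation for extended nonnegative integrals -/

section

variable {α : Type*} [MeasurableSpace α] {μ : Measure α}

lemma sq_lintegral_mul_le {f g : α → ENNReal} (hf : AEMeasurable f μ) (hg : AEMeasurable g μ) :
    (∫⁻ x, f x * g x ∂μ) ^ 2 ≤ (∫⁻ x, f x ^ 2 ∂μ) * ∫⁻ x, g x ^ 2 ∂μ := by
  have h := ENNReal.lintegral_mul_le_Lp_mul_Lq μ Real.HolderConjugate.two_two hf hg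
  simp only [Pi.mul_apply, ENNReal.rpow_two] at h
  refine (pow_le_pow_left₀ zero_le h 2).trans_eq ?_
  rw [mul_pow, ← ENNReal.rpow_mul_natCast, ← ENNReal.rpow_mul_natCast]
  norm_num

lemma add_sq_le_ennreal (a b : ENNReal) : (a + b) ^ 2 ≤ 2 * a ^ 2 + 2 * b ^ 2 := by
  rcases eq_or_ne a ⊤ with rfl | ha
  · simp
  rcases eq_or_ne b ⊤ with rfl | hb
  · simp
  lift a to NNReal using ha
  lift b to NNReal using hb
  have : (a + b) ^ 2 ≤ 2 * a ^ 2 + 2 * b ^ 2 := by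
    have : ((a + b) ^ 2 : ℝ) ≤ 2 * a ^ 2 + 2 * b ^ 2 := by nlinarith [sq_nonneg ((a : ℝ) - b)]
    exact_mod_cast this
  exact_mod_cast this

lemma lintegral_add_sq_le {f g : α → ENNReal} (hf : AEMeasurable f μ) :
    ∫⁻ x, (f x + g x) ^ 2 ∂μ ≤ 2 * (∫⁻ x, f x ^ 2 ∂μ) + 2 * ∫⁻ x, g x ^ 2 ∂μ := by
  refine (lintegral_mono fun x => add_sq_le_ennreal (f x) (g x)).trans_eq ?_
  rw [lintegral_add_left' ((hf.pow_const 2).const_mul 2), lintegral_const_mul' _ _ (by simp),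
    lintegral_const_mul' _ _ (by simp)]

lemma lintegral_enorm_sq_eq {u : α → ℂ} :
    ∫⁻ x, ‖u x‖ₑ ^ 2 ∂μ = eLpNorm u 2 μ ^ 2 := by
  rw [eLpNorm_eq_lintegral_rpow_enorm_toReal (by norm_num) (by norm_num),
    ← ENNReal.rpow_mul_natCast]
  norm_num

/-- Interpolation between `L²` and `L^∞`. -/
lemma eLpNorm_le_of_lintegral_sq_le {u : α → ℂ} {A M : ℝ} (hA : 0 < A) (hM : 0 < M)
    (h2 : ∫⁻ x, ‖u x‖ₑ ^ 2 ∂μ ≤ ENNReal.ofReal (A ^ 2))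
    (htop : ∀ᵐ x ∂μ, ‖u x‖ₑ ≤ ENNReal.ofReal M) {q : ENNReal} (hq : 2 ≤ q) :
    eLpNorm u q μ ≤
      ENNReal.ofReal (M ^ (1 - 2 * (q⁻¹).toReal) * A ^ (2 * (q⁻¹).toReal)) := by
  rcases eq_or_ne q ⊤ with rfl | hqt
  · rw [eLpNorm_exponent_top]
    simpa using eLpNormEssSup_le_of_ae_enorm_bound htop
  have hq0 : q ≠ 0 := fun h => by simp [h] at hq
  set s := q.toReal with hs
  have hs2 : 2 ≤ s := by
    have := ENNReal.toReal_mono hqt hq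
    simpa using this
  have hs0 : 0 < s := by linarith
  rw [eLpNorm_eq_lintegral_rpow_enorm_toReal hq0 hqt, ENNReal.toReal_inv, ← hs]
  have h3 : ∫⁻ x, ‖u x‖ₑ ^ s ∂μ ≤ ENNReal.ofReal (M ^ (s - 2) * A ^ 2) := by
    calc ∫⁻ x, ‖u x‖ₑ ^ s ∂μ ≤ ∫⁻ x, ENNReal.ofReal (M ^ (s - 2)) * ‖u x‖ₑ ^ 2 ∂μ := by
          refine lintegral_mono_ae (htop.mono fun x hx => ?_)
          have e1 : ‖u x‖ₑ ^ s = ‖u x‖ₑ ^ (s - 2) * ‖u x‖ₑ ^ 2 := by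
            rw [← ENNReal.rpow_two, ← ENNReal.rpow_add_of_nonneg _ _ (by linarith) (by norm_num)]
            congr 1
            ring
          rw [e1, ← ENNReal.ofReal_rpow_of_pos hM]
          gcongr
      _ = ENNReal.ofReal (M ^ (s - 2)) * ∫⁻ x, ‖u x‖ₑ ^ 2 ∂μ :=
          lintegral_const_mul' _ _ ENNReal.ofReal_ne_top
      _ ≤ _ := by
          rw [ENNReal.ofReal_mul (by positivity)]
          gcongr
  refine (ENNReal.rpow_le_rpow h3 (by positivity)).trans_eq ?_
  rw [ENNReal.ofReal_rpow_of_pos (by positivity), Real.mul_rpow (by positivity) (by positivity),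
    ← Real.rpow_mul hM.le, ← Real.rpow_natCast A 2, ← Real.rpow_mul hA.le]
  congr 3
  · field_simp
  · push_cast; ring

end

/-! ### Convolution with the weight on `L²` -/

section

variable {n : ℕ} {h : ℝ}

lemma measurable_weight : Measurable fun w : Space n => ENNReal.ofReal (weight h w) :=
  (continuous_weight h).measurable.ennreal_ofReal

lemma lintegral_weight (hh : 0 < h) : ∫⁻ w : Space n, ENNReal.ofReal (weight h w) =
    ENNReal.ofReal (∫ w : Space n, weight 1 w) := by
  rw [← ofReal_integral_eq_lintegral_ofReal (integrable_weight hh)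
    (Filter.Eventually.of_forall fun w => weight_nonneg hh w)]
  congr 1
  have e1 : ∀ w : Space n, weight h w = (h ^ n)⁻¹ * weight 1 (h⁻¹ • w) := fun w => by
    simp [weight]
  simp_rw [e1]
  rw [integral_const_mul, Measure.integral_comp_smul, finrank_euclideanSpace_fin,
    abs_of_pos (by positivity), smul_eq_mul, inv_pow, inv_inv, ← mul_assoc,
    inv_mul_cancel₀ (by positivity), one_mul]

lemma lintegral_weight_sq_le (hh : 0 < h) : ∫⁻ w : Space n, ENNReal.ofReal (weight h w) ^ 2 ≤
    ENNReal.ofReal ((h ^ n)⁻¹ * ∫ w : Space n, weight 1 w) := by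
  rw [ENNReal.ofReal_mul (by positivity), ← lintegral_weight hh,
    ← lintegral_const_mul' _ _ ENNReal.ofReal_ne_top]
  refine lintegral_mono fun w => ?_
  rw [sq]
  gcongr
  exact weight_le hh w

variable {G : Space n → ENNReal}

/-- Cauchy–Schwarz; the loss `h⁻ⁿ` is the squared `L²` norm of the weight, its supremum times its
mass. -/
lemma sq_lintegral_weight_mul_le (hh : 0 < h) (hG : AEMeasurable G) (x : Space n) :
    (∫⁻ z, ENNReal.ofReal (weight h (x - z)) * G z) ^ 2 ≤
      ENNReal.ofReal ((h ^ n)⁻¹ * ∫ w : Space n, weight 1 w) * ∫⁻ z, G z ^ 2 := by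
  have hm : Measurable fun z : Space n => ENNReal.ofReal (weight h (x - z)) :=
    measurable_weight.comp (measurable_const.sub measurable_id)
  refine (sq_lintegral_mul_le hm.aemeasurable hG).trans ?_
  gcongr
  rw [lintegral_sub_left_eq_self (fun w : Space n => ENNReal.ofReal (weight h w) ^ 2) x]
  exact lintegral_weight_sq_le hh

lemma aemeasurable_weight_mul (hG : AEMeasurable G) :
    AEMeasurable (fun p : Space n × Space n => ENNReal.ofReal (weight h (p.1 - p.2)) * G p.2)
      (volume.prod volume) :=
  (measurable_weight.comp (measurable_fst.sub measurable_snd)).aemeasurable.mul hG.comp_snd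

/-- Schur's test: Cauchy–Schwarz with the weight split as a product of square roots, followed by
Tonelli. The mass of the weight does not depend on `h`, so nothing is lost. -/
lemma lintegral_sq_lintegral_weight_mul_le (hh : 0 < h) (hG : AEMeasurable G) :
    ∫⁻ x, (∫⁻ z, ENNReal.ofReal (weight h (x - z)) * G z) ^ 2 ≤
      ENNReal.ofReal (∫ w : Space n, weight 1 w) ^ 2 * ∫⁻ z, G z ^ 2 := by
  have hm : ∀ x, Measurable fun z : Space n => ENNReal.ofReal (weight h (x - z)) := fun x =>
    measurable_weight.comp (measurable_const.sub measurable_id)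
  set I := ENNReal.ofReal (∫ w : Space n, weight 1 w) with hI
  have hp : ∀ x, (∫⁻ z, ENNReal.ofReal (weight h (x - z)) * G z) ^ 2 ≤
      I * ∫⁻ z, ENNReal.ofReal (weight h (x - z)) * G z ^ 2 := fun x => by
    have e1 : ∀ a : ENNReal, (a ^ (1 / 2 : ℝ)) ^ 2 = a := fun a => by
      rw [← ENNReal.rpow_mul_natCast]; norm_num
    have e2 := sq_lintegral_mul_le (μ := volume) ((hm x).pow_const (1 / 2 : ℝ)).aemeasurable
      (((hm x).pow_const (1 / 2 : ℝ)).aemeasurable.mul hG)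
    simp only [Pi.mul_apply, mul_pow, e1, ← mul_assoc, ← sq] at e2
    refine e2.trans ?_
    rw [lintegral_sub_left_eq_self (fun w : Space n => ENNReal.ofReal (weight h w)) x,
      lintegral_weight hh]
  calc _ ≤ ∫⁻ x, I * ∫⁻ z, ENNReal.ofReal (weight h (x - z)) * G z ^ 2 := lintegral_mono hp
    _ = I * ∫⁻ x, ∫⁻ z, ENNReal.ofReal (weight h (x - z)) * G z ^ 2 :=
        lintegral_const_mul' _ _ ENNReal.ofReal_ne_top
    _ = I * ∫⁻ z, ∫⁻ x, ENNReal.ofReal (weight h (x - z)) * G z ^ 2 := by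
        rw [lintegral_lintegral_swap (aemeasurable_weight_mul (hG.pow_const 2))]
    _ = I * ∫⁻ z, I * G z ^ 2 := by
        congr 2
        funext z
        have hz : Measurable fun x : Space n => ENNReal.ofReal (weight h (x - z)) :=
          measurable_weight.comp (measurable_id.sub measurable_const)
        rw [lintegral_mul_const _ hz,
          lintegral_sub_right_eq_self (fun w : Space n => ENNReal.ofReal (weight h w)) z,
          lintegral_weight hh]
    _ = _ := by rw [lintegral_const_mul' _ _ ENNReal.ofReal_ne_top, ← mul_assoc, sq]

end

/-! ### The elliptic estimate -/

lemma IsBump.comp {κ ι E : Type*} [NormedAddCommGroup E] [NormedSpace ℝ E] {R : ℝ}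
    {b : κ → E → ℂ} (hb : IsBump R b) (f : ι → κ) : IsBump R fun i => b (f i) where
  smooth i := hb.smooth (f i)
  support i := hb.support (f i)
  bound k := (hb.bound k).imp fun _ hC => ⟨hC.1, fun i => hC.2 (f i)⟩

variable {n : ℕ} {H : Set ℝ} {χ : ℝ → Phase n → ℂ}

lemma IsCutoff.exists_isBump (hχ : IsCutoff H χ) :
    ∃ R : ℝ, 0 ≤ R ∧ IsBump R fun i : H => χ i := by
  obtain ⟨K, hK, hχK⟩ := hχ.support
  obtain ⟨R, hR⟩ := hK.isBounded.subset_closedBall 0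
  refine ⟨max R 0, le_max_right _ _, ⟨fun i => hχ.symbol.smooth i i.2, fun i => ?_, fun k => ?_⟩⟩
  · exact ((hχK i i.2).trans hR).trans (Metric.closedBall_subset_closedBall (le_max_left _ _))
  · obtain ⟨C, hC⟩ := hχ.symbol.bound k
    refine ⟨|C|, abs_nonneg C, fun i z => ?_⟩
    have := hC i i.2 z
    rw [mul_one] at this
    exact this.trans (le_abs_self C)

/-- Only one power of `h` is needed from `O(h^∞)`: the family `r / h` is bounded in the Schwartz
space. -/
lemma IsNegligible.exists_norm_le (hH : H ⊆ Set.Ioc 0 1) {r : ℝ → 𝓢(Space n, ℂ)}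
    (hr : IsNegligible H r) :
    ∃ C : ℝ, 0 ≤ C ∧ ∀ h ∈ H, ∀ x, ‖r h x‖ ≤ C * h * weight 1 x := by
  have hb : IsBoundedSchwartz fun i : H => (i : ℝ)⁻¹ • r i := fun k l => by
    obtain ⟨C, hC⟩ := hr k l 1
    refine ⟨C, fun i => ?_⟩
    have hi := (hH i.2).1
    rw [map_smul_eq_mul, norm_inv, Real.norm_of_nonneg hi.le, inv_mul_le_iff₀ hi, mul_comm]
    simpa using hC i i.2
  obtain ⟨C, hC0, hC⟩ := hb.norm_le (n + 1)
  refine ⟨C, hC0, fun h hh x => ?_⟩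
  have hi := (hH hh).1
  have := hC ⟨h, hh⟩ x
  rw [smul_apply, norm_smul, norm_inv, Real.norm_of_nonneg hi.le, inv_mul_le_iff₀ hi] at this
  refine this.trans_eq ?_
  simp only [weight, inv_one, one_smul, one_pow, one_mul]
  ring

/-- An elliptic symbol is inverted modulo `O(h)`: the approximate solution is controlled pointwise
by an average of `|f| + h|u|` at scale `h`. -/
lemma exists_enorm_le_lintegral (hH : H ⊆ Set.Ioc 0 1) {m : Phase n → ℝ} (hm : IsOrderFunction m)
    {a p : ℝ → Phase n → ℂ} (hp : IsPrincipalSymbol H m a p) {u : ℝ → Space n → ℂ}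
    (hu : IsLocalizedBy H χ u)
    (hell : ∃ c : ℝ, 0 < c ∧ ∀ h ∈ H, ∀ z ∈ tsupport (χ h), c ≤ ‖p h z‖) :
    ∃ C : ℝ, 0 ≤ C ∧ ∀ h ∈ H, ∀ f : Space n → ℂ, QuantizationEq h (a h) (u h) f →
      ∀ᵐ x, ‖u h x‖ₑ ≤ ENNReal.ofReal (C * h * weight 1 x) + ENNReal.ofReal C *
        ∫⁻ z, ENNReal.ofReal (weight h (x - z)) * (‖f z‖ₑ + ENNReal.ofReal h * ‖u h z‖ₑ) := by
  obtain ⟨R, hR, hχ⟩ := hu.cutoff.exists_isBump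
  obtain ⟨c, hc, hell⟩ := hell
  obtain ⟨Cu, hCu⟩ := hu.bounded
  obtain ⟨r, hr, hloc⟩ := hu.localized
  obtain ⟨C₀, N, hC₀, hmN⟩ := hm.exists_le
  set d : ℝ → Phase n → ℂ := fun h z => (h : ℂ)⁻¹ * (a h z - p h z) with hd
  have hsub : ∀ i : H, (i : ℝ) ∈ H := fun i => i.2
  have hpA := hp.principal.isAmplitude hC₀ hm.nonneg hmN hsub
  have hdA := hp.difference.isAmplitude hC₀ hm.nonneg hmN hsub
  have hpne : ∀ i : H, ∀ z ∈ tsupport (χ i), p i z ≠ 0 := fun i z hz =>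
    norm_pos_iff.1 (hc.trans_le (hell i i.2 z hz))
  have hbB : IsBump R fun (i : H) z => χ i z * (p i z)⁻¹ := by
    refine hχ.mul (U := fun i : H => {z | p i z ≠ 0})
      (fun i => isOpen_ne_fun (hpA.smooth i).continuous continuous_const) hpne
      (fun i => (hpA.smooth i).contDiffOn.inv fun z hz => hz) ?_
    exact exists_norm_iteratedFDeriv_inv_le hc hpA.smooth (fun i => hell i i.2)
      (hpA.bound_ball hR hχ.support)
  have hYB : IsBump R fun (i : H) z => χ i z * (p i z)⁻¹ * d i z :=
    hbB.mul (U := fun _ => Set.univ) (fun i => isOpen_univ) (fun i => Set.subset_univ _)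
      (fun i => (hdA.smooth i).contDiffOn) (hdA.bound_ball hR hbB.support)
  -- Indexing by pairs `(h, x)` makes the constants uniform in both. The bound on `x` costs nothing,
  -- since the kernel rows vanish outside the ball.
  let ι := {z : ℝ × Space n // z.1 ∈ H ∧ ‖z.2‖ ≤ R}
  let e : ι → H := fun i => ⟨i.1.1, i.2.1⟩
  let hι : ι → ℝ := fun i => i.1.1
  let xι : ι → Space n := fun i => i.1.2
  have h0 : ∀ i, 0 < hι i := fun i => (hH i.2.1).1
  have h1 : ∀ i, hι i ≤ 1 := fun i => (hH i.2.1).2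
  obtain ⟨X, hX, -⟩ := (hχ.comp e).exists_slice xι
  obtain ⟨b, hb, hbS⟩ := (hbB.comp e).exists_slice xι
  obtain ⟨Y, hY, hYS⟩ := (hYB.comp e).exists_slice xι
  have haA := hp.full.isAmplitude (h := hι) hC₀ hm.nonneg hmN fun i => i.2.1
  obtain ⟨C₁, hC₁0, hC₁⟩ := exists_norm_quantizationTranspose_sub_le (χ := fun i => χ (hι i))
    haA hR (fun i => i.2.2) h0 h1 hbS hYS hX fun i ξ => by
      rw [hb, hX, hY]
      change a (hι i) (xι i, ξ) * (χ (hι i) (xι i, ξ) * (p (hι i) (xι i, ξ))⁻¹) =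
        χ (hι i) (xι i, ξ) + (hι i : ℂ) * (χ (hι i) (xι i, ξ) * (p (hι i) (xι i, ξ))⁻¹ *
          ((hι i : ℂ)⁻¹ * (a (hι i) (xι i, ξ) - p (hι i) (xι i, ξ))))
      -- The identity `a b = χ + hY` needs `p ≠ 0` only on the support; elsewhere every term
      -- contains the factor `χ = 0`.
      by_cases hz : (xι i, ξ) ∈ tsupport (χ (hι i))
      · have e1 := hpne (e i) _ hz
        have e2 : p (hι i) (xι i, ξ) ≠ 0 := e1
        have e3 : (hι i : ℂ) ≠ 0 := Complex.ofReal_ne_zero.2 (h0 i).ne'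
        field_simp
        ring
      · rw [image_eq_zero_of_notMem_tsupport hz]
        ring
  obtain ⟨C₂, hC₂0, hC₂⟩ := exists_norm_quantizationKernel_le hχ (h := fun i : H => (i : ℝ))
    fun i => (hH i.2).1
  obtain ⟨C₃, hC₃0, hC₃⟩ := hr.exists_norm_le hH
  refine ⟨C₁ + C₂ + C₃, by positivity, fun h hh f huf => ?_⟩
  have hpos := (hH hh).1
  have hχc : Continuous (χ h) := (hχ.smooth ⟨h, hh⟩).continuous
  have hae := ae_eq_integral_kernel_of_quantizationEq hpos hχc (hχ.support ⟨h, hh⟩) hC₂0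
    (hC₂ ⟨h, hh⟩) (hCu h hh).1 ((hCu h hh).1.sub ((r h).memLp 2)) (hloc h hh)
  filter_upwards [hae] with x hx
  have e1 : u h x = r h x + ∫ z, u h z * quantizationKernel h (χ h) x z := by
    rw [← hx, Pi.sub_apply]; ring
  have hw1 := weight_nonneg one_pos x
  rw [e1]
  refine (enorm_add_le _ _).trans (add_le_add ?_ ?_)
  · rw [← ofReal_norm]
    refine ENNReal.ofReal_le_ofReal ((hC₃ h hh x).trans ?_)
    gcongr
    linarith
  · rcases le_or_gt ‖x‖ R with hxR | hxR
    · obtain ⟨φ, hφ, hdφ, hdm⟩ := hC₁ ⟨(h, x), hh, hxR⟩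
      refine enorm_integral_kernel_le hpos hχc (by positivity) (hCu h hh).1 huf
        (fun z => (hC₂ ⟨h, hh⟩ x z).trans ?_) (fun y => (hφ y).trans ?_)
        (fun z => (hdφ z).trans ?_) hdm
      · exact mul_le_mul_of_nonneg_right (by linarith) (weight_nonneg hpos _)
      · exact mul_le_mul_of_nonneg_right (by linarith) (weight_nonneg hpos _)
      · exact mul_le_mul_of_nonneg_right (mul_le_mul_of_nonneg_right (by linarith) hpos.le)
          (weight_nonneg hpos _)
    · simp [quantizationKernel_eq_zero (hχ.support ⟨h, hh⟩) hxR]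

/-- The `L²` and `L^∞` bounds for elliptic quasimodes. -/
lemma exists_lintegral_sq_le_and_enorm_le (hH : H ⊆ Set.Ioc 0 1) {m : Phase n → ℝ}
    (hm : IsOrderFunction m) {a p : ℝ → Phase n → ℂ} (hp : IsPrincipalSymbol H m a p)
    {u : ℝ → Space n → ℂ} (hu : IsLocalizedBy H χ u) (hPu : IsApproximateSolution H a u)
    (hell : ∃ c : ℝ, 0 < c ∧ ∀ h ∈ H, ∀ z ∈ tsupport (χ h), c ≤ ‖p h z‖) :
    ∃ D : ℝ, 0 < D ∧ ∀ h ∈ H, ∫⁻ x, ‖u h x‖ₑ ^ 2 ≤ ENNReal.ofReal ((D * h) ^ 2) ∧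
      ∀ᵐ x, ‖u h x‖ₑ ≤ ENNReal.ofReal (D * h ^ (1 - (n : ℝ) / 2)) := by
  obtain ⟨C, hC0, hC⟩ := exists_enorm_le_lintegral hH hm hp hu hell
  obtain ⟨Cu, hCu⟩ := hu.bounded
  obtain ⟨Cf, hCf⟩ := hPu
  set I := ∫ w : Space n, weight 1 w with hI
  have hI0 : 0 ≤ I := integral_nonneg fun w => weight_nonneg one_pos w
  set S := 2 * Cf ^ 2 + 2 * Cu ^ 2 with hS
  have hS0 : 0 ≤ S := by positivity
  set D₁ := 2 * C ^ 2 * I + 2 * (C ^ 2 * (I ^ 2 * S)) with hD₁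
  set D₂ := C + C * √(I * S) with hD₂
  have hD₁0 : 0 ≤ D₁ := by positivity
  have hD₂0 : 0 ≤ D₂ := by positivity
  -- `D₁` bounds the square of the `L²` constant and `D₂` the `L^∞` constant. The summand `1` gives
  -- positivity and `D₁ ≤ D²` without a square root.
  refine ⟨1 + D₁ + D₂, by positivity, fun h hh => ?_⟩
  obtain ⟨hpos, hle1⟩ := hH hh
  obtain ⟨f, hf2, huf, hfn⟩ := hCf h hh
  obtain ⟨hu2, hun⟩ := hCu h hh
  have hpt := hC h hh f huf
  set G : Space n → ENNReal := fun z => ‖f z‖ₑ + ENNReal.ofReal h * ‖u h z‖ₑ with hG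
  have hGm : AEMeasurable G := hf2.1.enorm.add (hu2.1.enorm.const_mul _)
  have hsq : ∀ {v : Space n → ℂ} {c : ℝ}, eLpNorm v 2 volume ≤ ENNReal.ofReal c →
      ∫⁻ z, ‖v z‖ₑ ^ 2 ≤ ENNReal.ofReal (c ^ 2) := fun {v c} hv => by
    rw [lintegral_enorm_sq_eq]
    refine (pow_le_pow_left₀ zero_le hv 2).trans ?_
    rcases le_total 0 c with hc | hc
    · rw [ENNReal.ofReal_pow hc]
    · rw [ENNReal.ofReal_of_nonpos hc]; simp
  have hG2 : ∫⁻ z, G z ^ 2 ≤ ENNReal.ofReal (S * h ^ 2) := by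
    refine (lintegral_add_sq_le hf2.1.enorm).trans ?_
    have e1 := hsq hfn
    have e2 := hsq hun
    simp only [mul_pow]
    rw [lintegral_const_mul' _ _ (by simp)]
    calc _ ≤ 2 * ENNReal.ofReal ((Cf * h) ^ 2) +
          2 * (ENNReal.ofReal h ^ 2 * ENNReal.ofReal (Cu ^ 2)) := by gcongr
      _ = ENNReal.ofReal (2 * (Cf * h) ^ 2 + 2 * (h ^ 2 * Cu ^ 2)) := by
          rw [ENNReal.ofReal_add (by positivity) (by positivity), ENNReal.ofReal_mul two_pos.le,
            ENNReal.ofReal_mul two_pos.le, ENNReal.ofReal_mul (by positivity),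
            ENNReal.ofReal_pow hpos.le]
          simp
      _ = _ := by congr 1; rw [hS]; ring
  constructor
  · have hT := lintegral_sq_lintegral_weight_mul_le hpos hGm
    have hW := lintegral_weight_sq_le (n := n) one_pos
    rw [one_pow, inv_one, one_mul] at hW
    have hm1 : AEMeasurable fun x : Space n => ENNReal.ofReal (C * h * weight 1 x) :=
      ((continuous_weight (n := n) 1).measurable.const_mul (C * h)).ennreal_ofReal.aemeasurable
    calc ∫⁻ x, ‖u h x‖ₑ ^ 2
        ≤ ∫⁻ x, (ENNReal.ofReal (C * h * weight 1 x) + ENNReal.ofReal C *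
            ∫⁻ z, ENNReal.ofReal (weight h (x - z)) * G z) ^ 2 :=
          lintegral_mono_ae (hpt.mono fun x hx => pow_le_pow_left₀ zero_le hx 2)
      _ ≤ 2 * (∫⁻ x : Space n, ENNReal.ofReal (C * h * weight 1 x) ^ 2) +
          2 * ∫⁻ x, (ENNReal.ofReal C *
            ∫⁻ z, ENNReal.ofReal (weight h (x - z)) * G z) ^ 2 := lintegral_add_sq_le hm1
      _ ≤ 2 * (ENNReal.ofReal (C * h) ^ 2 * ENNReal.ofReal I) +
          2 * (ENNReal.ofReal C ^ 2 * (ENNReal.ofReal I ^ 2 * ENNReal.ofReal (S * h ^ 2))) := by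
          have e1 : ∀ x : Space n, ENNReal.ofReal (C * h * weight 1 x) =
              ENNReal.ofReal (C * h) * ENNReal.ofReal (weight 1 x) := fun x =>
            ENNReal.ofReal_mul (by positivity)
          simp only [e1, mul_pow]
          rw [lintegral_const_mul' _ _ (by simp), lintegral_const_mul' _ _ (by simp)]
          gcongr
          exact hT.trans (by gcongr)
      _ = ENNReal.ofReal (2 * ((C * h) ^ 2 * I) + 2 * (C ^ 2 * (I ^ 2 * (S * h ^ 2)))) := by
          rw [ENNReal.ofReal_add (by positivity) (by positivity), ENNReal.ofReal_mul two_pos.le,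
            ENNReal.ofReal_mul two_pos.le, ENNReal.ofReal_mul (p := (C * h) ^ 2) (by positivity),
            ENNReal.ofReal_mul (p := C ^ 2) (by positivity),
            ENNReal.ofReal_mul (p := I ^ 2) (by positivity),
            ENNReal.ofReal_pow (p := C * h) (by positivity), ENNReal.ofReal_pow hC0,
            ENNReal.ofReal_pow hI0]
          simp
      _ ≤ _ := by
          refine ENNReal.ofReal_le_ofReal ?_
          have e1 : 2 * ((C * h) ^ 2 * I) + 2 * (C ^ 2 * (I ^ 2 * (S * h ^ 2))) = D₁ * h ^ 2 := by
            rw [hD₁]; ring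
          rw [e1, mul_pow]
          gcongr
          nlinarith
  · filter_upwards [hpt] with x hx
    refine hx.trans ?_
    have hexp : h ≤ h ^ (1 - (n : ℝ) / 2) := by
      conv_lhs => rw [← Real.rpow_one h]
      exact Real.rpow_le_rpow_of_exponent_ge hpos hle1 (by linarith [n.cast_nonneg (α := ℝ)])
    have hT : ∫⁻ z, ENNReal.ofReal (weight h (x - z)) * G z ≤
        ENNReal.ofReal (√(I * S) * h ^ (1 - (n : ℝ) / 2)) := by
      -- After squaring, the Cauchy–Schwarz loss `h⁻ⁿ` times the `h²` from `G` is exactly the square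
      -- of `h ^ (1 - n/2)`.
      rw [← (ENNReal.pow_right_strictMono two_ne_zero).le_iff_le]
      beta_reduce
      refine ((sq_lintegral_weight_mul_le hpos hGm x).trans
        (mul_le_mul_right hG2 _)).trans_eq ?_
      rw [← ENNReal.ofReal_mul (by positivity), ← ENNReal.ofReal_pow (by positivity), mul_pow,
        Real.sq_sqrt (by positivity), ← Real.rpow_mul_natCast hpos.le]
      have e1 : h ^ ((1 - (n : ℝ) / 2) * ((2 : ℕ) : ℝ)) = (h ^ n)⁻¹ * h ^ 2 := by
        rw [← Real.rpow_natCast h n, ← Real.rpow_natCast h 2, ← Real.rpow_neg hpos.le,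
          ← Real.rpow_add hpos]
        congr 1
        push_cast
        ring
      rw [e1]
      congr 1
      ring
    have hw : weight 1 x ≤ 1 := by simpa using weight_le one_pos x
    calc _ ≤ ENNReal.ofReal (C * h ^ (1 - (n : ℝ) / 2)) +
          ENNReal.ofReal C * ENNReal.ofReal (√(I * S) * h ^ (1 - (n : ℝ) / 2)) := by
          refine add_le_add (ENNReal.ofReal_le_ofReal ?_) (by gcongr)
          exact (mul_le_of_le_one_right (by positivity) hw).trans (by gcongr)
      _ = ENNReal.ofReal (D₂ * h ^ (1 - (n : ℝ) / 2)) := by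
          rw [← ENNReal.ofReal_mul hC0, ← ENNReal.ofReal_add (by positivity) (by positivity)]
          congr 1
          rw [hD₂]
          ring
      _ ≤ _ := by
          refine ENNReal.ofReal_le_ofReal ?_
          gcongr
          linarith

end Semiclassical

theorem mainTheorem9 (n : ℕ) (H : Set ℝ) (hH : H ⊆ Set.Ioc 0 1)
    (m : Semiclassical.Phase n → ℝ) (hm : Semiclassical.IsOrderFunction m)
    (a p : ℝ → Semiclassical.Phase n → ℂ) (hp : Semiclassical.IsPrincipalSymbol H m a p)
    (χ : ℝ → Semiclassical.Phase n → ℂ) (u : ℝ → Semiclassical.Space n → ℂ)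
    (hu : Semiclassical.IsLocalizedBy H χ u)
    (hPu : Semiclassical.IsApproximateSolution H a u)
    (hell : ∃ c : ℝ, 0 < c ∧ ∀ h ∈ H, ∀ z ∈ tsupport (χ h), c ≤ ‖p h z‖)
    (q : ENNReal) (hq : 2 ≤ q) :
    ∃ C : ℝ, ∀ h ∈ H,
      MeasureTheory.eLpNorm (u h) q MeasureTheory.volume ≤
        ENNReal.ofReal (C * h ^ (1 - (n : ℝ) * (1 / 2 - (q⁻¹).toReal))) := by
  obtain ⟨D, hD, hDu⟩ :=
    Semiclassical.exists_lintegral_sq_le_and_enorm_le hH hm hp hu hPu hell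
  refine ⟨D, fun h hh => ?_⟩
  have hpos := (hH hh).1
  refine (Semiclassical.eLpNorm_le_of_lintegral_sq_le (by positivity) (by positivity)
    (hDu h hh).1 (hDu h hh).2 hq).trans_eq ?_
  congr 1
  -- The exponents of `D` add up to `1`, and those of `h` to `(1 - n/2)(1 - 2/q) + 2/q = 1 - n(1/2 -
  -- 1/q)`.
  rw [Real.mul_rpow hD.le (by positivity), Real.mul_rpow hD.le hpos.le, ← Real.rpow_mul hpos.le,
    mul_mul_mul_comm, ← Real.rpow_add hD, ← Real.rpow_add hpos, sub_add_cancel, Real.rpow_one]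
  congr 2
  ring
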